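/- **Setting: the CPM language.** Fix a set $\mathrm{Loc}$ of locations and an open-ended set $\mathrm{RTSExcept}$ of run-time exceptions containing $\mathtt{divbyzero},\mathtt{stkovflw},\mathtt{datovflw},\mathtt{memerror}$. Storable values $v$ are integers and Booleans; exceptions $\xi$ are run-time exceptions or storable values. Storable types $T$ are integer and boolean. Expressions $e$ are built from constants and identifiers with $-$, $+,-,*,/,\%$, the six comparisons, and the short-circuit $\mathbf{not},\mathbf{and},\mathbf{or}$ ($/$ and $\%$ truncate). Local declarations $d$ are $\mathbf{nil}$, $\mathbf{lvar}\ x:T=e$, $d_0;d_1$ and, in configurations only, environments $\rho$ and $\mathbf{rec}\,\rho$. Global declarations $g$ are $\mathbf{gvar}\ x:T=e$, $\mathbf{function}\ f(\mathit{fps})=\mathit{body}$, $\mathbf{rec}\ g$ and $g_0;g_1$. Function bodies are $\mathbf{let}\ d\ \mathbf{in}\ s\ \mathbf{result}\ e$ and $\mathbf{extern}:T$. Statements $s$ are $\mathbf{nop}$, $x:=e$, $x_0:=f(e_1,\dots,e_n)$, $s_0;s_1$, the block $d;s$, $\mathbf{if}$, $\mathbf{while}$, $\mathbf{throw}\,\chi$,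 $\mathbf{throw}\,e$, $\mathbf{try}\ s\ \mathbf{catch}\ k$, and $\mathbf{try}\ s_0\ \mathbf{finally}\ s_1$. Catch clauses $k$ are $(p)\,s$ and $k_0;k_1$, where $p$ is a run-time exception, a catchable type ("run-time exception", integer or boolean), $x:T$ or $\mathbf{any}$. Environments $\rho$ map finitely many identifiers to typed addresses (a location, or an index into the top stack frame, with a storable type) or to closures $\lambda\mathit{fps}.\mathit{body}$; type environments $\beta$ map finitely many identifiers to location types or function types. $\beta[\beta']$, $\rho[\rho']$ denote update, $|_J$ restriction, $\setminus J$ restriction to the complement of $J$, and FI, DI the free and the defined identifiers. The judgements "$e$, $s$, $k$ are well typed in $\beta$", "a body has a storable type in $\beta$", "$\beta\vdash d:\delta$, $\beta\vdash g:\delta$" (a declaration produces the type environment $\delta$; $\mathbf{rec}$ allows no variables) and $\rho:\beta$ are the usual ones. A memory structure $\sigma$ is a pair of a partial map from pairs (location, storable type) to storable values, and a stack, i.e. a word of locations, stack markers $\dagger$ and frame markers $\ddagger$ without repeated locations; the top frame is the longest suffix without $\ddagger$. Reading an undefined cell, writing an undefined cell, and writing a value of the wrong type give $\mathtt{memerror}$.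 Writing keeps the domain of the map, sets the written cell, and keeps all cells at other locations; allocation in the data segment or on the stack ($\mathrm{new}_d$, $\mathrm{new}_s$) either overflows or stores the value at a fresh location without changing existing cells ($\mathrm{new}_s$ also pushes the location, addressed by its index in the top frame). Fix any, possibly nondeterministic, implementation of these underspecified operations. Also: $\mathrm{cleanup}_d$ empties the memory of an exception state; $\mathrm{mark}$ pushes $\dagger$; the partial operations $\mathrm{unmark}$ (pops the top $\dagger$ with the locations above it, and erases these locations), $\mathrm{link}$ and $\mathrm{unlink}$ (replace a top marker $\dagger$ by $\ddagger$, resp. $\ddagger$ by $\dagger$, only locations lying above it). A value state is a pair $(v,\sigma)$, an exception state $\varepsilon$ a pair $(\sigma,\xi)$. **Concrete semantics.** A non-terminal configuration $N$ is $\langle c,\sigma\rangle$ with $c$ an expression, local or global declaration, statement or body (kinds e, d, g, s, b), or $\langle k,\varepsilon\rangle$ with $k$ a catch clause (kind k). A terminal configuration $\eta$ is an exception state or, respectively: a value state (e); a pair $\langle\rho',\sigma'\rangle$ (d, g); a memory structure (s, b); for kind k, it is either $\langle\mathtt{caught},\eta_s\rangle$ with $\eta_s$ a terminal configuration of statements or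 $\langle\mathtt{uncaught},\varepsilon\rangle$. Concrete sequents are $\rho\vdash_\beta N\to\eta$ and, for divergence, $\rho\vdash_\beta N\stackrel{\infty}{\to}$. In every sequent, concrete or abstract, the construct in $N$ is well typed in $\beta$ and $\rho:\beta|_{\mathrm{dom}\,\rho}$. The positive rules are the standard left-to-right big-step rules, with exception states propagated, in which: - division or remainder by $0$ yields $\mathtt{divbyzero}$; - an exception in $\mathbf{gvar}$ is cleaned up, and one in $\mathbf{lvar}$ is unmarked; variables are bound to freshly allocated addresses; - a function declaration binds $f$ to the closure whose body $\mathbf{let}\ d\dots$ is replaced by $\mathbf{let}\ \rho|_I;d\dots$, with $I=\mathrm{FI}(\mathit{body})\setminus\mathrm{DI}(\mathit{fps})$; $\mathbf{rec}\ \rho_0$ evaluates to the environment in which each closure $\lambda\mathit{fps}.\mathbf{let}\ d\dots$ of $\rho_0$ is replaced by $\lambda\mathit{fps}.\mathbf{let}\ \mathbf{rec}(\rho_0\setminus\mathrm{DI}(\mathit{fps}));d\dots$; extern bodies are kept in both cases; - $\mathbf{rec}\ g$ evaluates $g$ under $\rho\setminus J$ and $\beta[\beta_0|_J]$, where $J=\mathrm{FI}(g)\cap\mathrm{DI}(g)$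 and $\beta\vdash\mathbf{rec}\ g:\beta_0$, to $\langle\rho_0,\sigma_0\rangle$, and then $\mathbf{rec}\ \rho_0$; - sequential declarations, blocks and bodies evaluate their continuation under $\rho[\rho_0]$ and $\beta[\beta_0]$, with $\rho_0,\beta_0$ the environment and type environment of the first declaration; - blocks, bodies and catch clauses $(x:T)\,s$ mark the stack first and unmark it at the end; a body ends with the assignment $\underline{x}_0:=e$ to the reserved identifier $\underline x_0$; - a call $x_0:=f(e_1,\dots,e_n)$, with $f$ of return type $T_0$ bound to $\lambda x_1:T_1,\dots,x_n:T_n.\mathit{body}$, marks the stack, evaluates $\mathbf{lvar}\ \underline x_0:T_0=x_0;\mathbf{lvar}\ \underline x_1:T_1=e_1;\dots;\mathbf{lvar}\ \underline x_n:T_n=e_n$ to $\rho_0$, links, evaluates $\mathit{body}$ under $\rho[\rho_1]$ with $\rho_1=\{\underline x_0\mapsto(0,T_0),x_j\mapsto(j,T_j)\}$, unlinks, evaluates $x_0:=\underline x_0$ under $\rho[\rho_0]$, and unmarks; - $\mathbf{extern}:T$ may change the map of the memory arbitrarily, keeping the stack, and may raise any exception; - $(p)\,s$ catches $\xi$ if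 $p=\mathbf{any}$, $p=\xi$, $p=\mathrm{type}(\xi)$ or $p=(x:\mathrm{type}(\xi))$, binding $x$ to $\xi$ in the last case; $k_0;k_1$ tries $k_1$ if $k_0$ does not catch; a normally terminating $\mathbf{finally}$ part re-raises the pending exception. For each positive rule instance whose conclusion and $i$-th premise are of kind s, b or k, there is the negative rule with the premises before the $i$-th, the $i$-th premise with its result replaced by divergence, and the divergent conclusion. A tree is a partial function $\theta$ on $\mathbb N^*$ with prefix-closed domain such that the children of each $z$ are numbered $0,\dots,h-1$; $\theta_{[i]}$ is the subtree at $i$ and $\theta(\epsilon)$ the root. $\Theta_+$ is the least set of sequent-labelled trees generated by the positive rules. $\Theta_-$ is the greatest set of trees whose root with its children is an instance of a negative rule, the last immediate subtree being in $\Theta_-$ and all the others in $\Theta_+$. Put $\Theta=\Theta_+\cup\Theta_-$. **Abstract semantics.** Fix join-semilattices with bottom $\mathrm{Int}^\sharp,\mathrm{RTS}^\sharp$ (with top) and $\mathrm{Mem}^\sharp$, and a complete lattice $\mathrm{Bool}^\sharp$, with monotone concretizations $\gamma$ to sets of integers, run-time exceptions, memory structures and Booleans satisfying $\gamma(\bot)=\emptyset$,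 and partial abstraction functions $\alpha$ with $c\subseteq\gamma(\alpha(c))$ and $\alpha(\emptyset)=\bot$; for integers and run-time exceptions $\alpha$ is defined on singletons and maps the full set to $\top$; for Booleans $(\alpha,\gamma)$ is a Galois connection. Let $\mathrm{sVal}^\sharp=\mathrm{Int}^\sharp\times\mathrm{Bool}^\sharp$ and $\mathrm{Exc}^\sharp=\mathrm{RTS}^\sharp\times\mathrm{sVal}^\sharp$ (approximating disjoint unions), $\mathrm{ValState}^\sharp=\mathrm{sVal}^\sharp\otimes\mathrm{Mem}^\sharp$ and $\mathrm{ExcState}^\sharp=\mathrm{Mem}^\sharp\otimes\mathrm{Exc}^\sharp$, where $A\otimes B=\{(a,b): a=\bot\iff b=\bot\}$, with constructor $a\otimes b=(a,b)$ if $a,b\ne\bot$ and $\bot$ otherwise. Abstract non-terminal configurations $N^\sharp$ have $\sigma^\sharp\in\mathrm{Mem}^\sharp$ (resp. $\varepsilon^\sharp\in\mathrm{ExcState}^\sharp$) in place of $\sigma$ (resp. $\varepsilon$). Abstract terminal configurations $\eta^\sharp$ are pairs $\langle\cdot,\varepsilon^\sharp\rangle$ whose first component is an abstract value state (e), a pair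 $(\rho',\sigma^\sharp)$ (d, g), a $\sigma^\sharp$ (s, b), or a pair $(\sigma^\sharp,\varepsilon_1^\sharp)$ describing caught exceptions (k). They are ordered componentwise, environments only by equality. The relation $\propto$ is the componentwise one ($x\propto x^\sharp$ iff $x\in\gamma(x^\sharp)$ on base domains); for configurations, constructs and environments must be equal. A concrete and an abstract sequent satisfy $\propto$ if they have the same $\rho,\beta$ and $N\propto N^\sharp$ and, unless the concrete one is divergent, $\eta\propto\eta^\sharp$. Fix operators on these domains that are sound for the corresponding concrete ones: integer and Boolean operations and tests, read, write, $\mathrm{cleanup}_d^\sharp,\mathrm{mark}^\sharp,\mathrm{unmark}^\sharp,\mathrm{link}^\sharp,\mathrm{unlink}^\sharp$; allocation operators $\mathrm{new}^\sharp_d,\mathrm{new}^\sharp_s$, which may be partial, return $((\sigma^\sharp,a),\varepsilon^\sharp)$ such that every concrete result on a described state is either an overflow described by $\varepsilon^\sharp$ or a pair $(\sigma,a)$ with this same address $a$ and $\sigma\propto\sigma^\sharp$. Fix a filter $\phi(\rho,\sigma^\sharp,e)$ describing every memory $\sigma'$ such that $\rho\vdash_\beta\langle e,\sigma\rangle\to\langle\mathrm{tt},\sigma'\rangle$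 is derivable for some $\sigma\propto\sigma^\sharp$ and some $\beta$ with $e$ boolean in $\beta$ and $\rho:\beta|_{\mathrm{dom}\,\rho}$; filters $\phi^{\pm}(p,\varepsilon^\sharp)$ describing the states described by $\varepsilon^\sharp$ whose exceptions are, resp. are not, caught by $p$; and, for configurations of kinds e, d, g, s, a relation $\mathrm{supported}^\sharp(\rho,N^\sharp)$ and a partial function $\mathrm{eval}^\sharp(\rho,N^\sharp)$ such that, whenever $\mathrm{supported}^\sharp(\rho,N^\sharp)$ holds, $\rho:\beta|_{\mathrm{dom}\,\rho}$ and the construct is well typed in $\beta$, the value $\mathrm{eval}^\sharp(\rho,N^\sharp)$ is defined and describes every $\eta$ with $\rho\vdash_\beta N\to\eta$ derivable for some $N\propto N^\sharp$. The abstract rules compute one abstract result per construct, by the abstract counterparts of the concrete rules. Subterms are evaluated in the same order, all exception components are joined, and pairs are built with $\otimes$. In particular: - constants, run-time exceptions and $\mathtt{divbyzero}$ use $\alpha$ on singletons; premises of arithmetic (resp. Boolean) operations must have pure abstract integers (resp. Booleans) as values; $\mathtt{divbyzero}$ is added when $0$ is described by the divisor; - $e_0\,\mathbf{and}\,e_1$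 has premises $e_0$ on $\sigma^\sharp$ and $e_1$ on $\phi(\rho,\sigma^\sharp,e_0)$, and value $(\alpha(\{\mathrm{ff}\})\otimes\phi(\rho,\sigma^\sharp,\mathbf{not}\,e_0))\sqcup\upsilon_1^\sharp$; $\mathbf{or}$ is dual; - $\mathbf{if}$ has premises for the guard, for $s_0$ on $\phi(\rho,\sigma^\sharp,e)$ and for $s_1$ on $\phi(\rho,\sigma^\sharp,\mathbf{not}\,e)$, whose results are joined; $\mathbf{while}$ has premises for the guard, for the body on $\phi(\rho,\sigma^\sharp,e)$ and for the loop itself on the result of the body, and result $\phi(\rho,\sigma^\sharp,\mathbf{not}\,e)$ joined with that of the last premise; - the first premise of $\mathbf{rec}\ g$ must have exception component $\bot$; - $\mathbf{try}/\mathbf{catch}$ evaluates $k$ on the exception component of $s$; $\mathbf{finally}$ evaluates $s_1$ both on the normal result $\sigma_0^\sharp$ of $s_0$ and on the memory of its exception component; - $\mathbf{extern}$ yields $\langle\sigma_0^\sharp,\sigma_0^\sharp\otimes\top\rangle$ for any $\sigma^\sharp_0$ describing all memories with the same stack as a memory described by $\sigma^\sharp$; - $(p)\,s$ evaluates $s$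 on the memory of $\phi^+(p,\varepsilon^\sharp)$ (for $p=(x:T)$: uses $\phi^{\pm}(T,\cdot)$, marks the stack, allocates $x$ with the component of type $T$ of the abstract exception, and unmarks the results), with uncaught part $\phi^-(p,\varepsilon^\sharp)$ (resp. $\phi^-(T,\varepsilon^\sharp)$); $k_0;k_1$ evaluates $k_1$ on the uncaught part of $k_0$. The result in the conclusion may be replaced by any larger one; when $\mathrm{supported}^\sharp(\rho,N^\sharp)$ holds, the result is instead any $\eta^\sharp\sqsupseteq\mathrm{eval}^\sharp(\rho,N^\sharp)$, the premises being kept. $\Theta^\sharp$ is the greatest set of (possibly infinite) trees of abstract sequents $\rho\vdash_\beta N^\sharp\to\eta^\sharp$ generated by these rules. The relation $\theta\propto\theta^\sharp$ on $\Theta\times\Theta^\sharp$ is the greatest relation such that $\theta\propto\theta^\sharp$ implies $\theta(\epsilon)\propto\theta^\sharp(\epsilon)$ and that for every immediate subtree $\theta_{[i]}$ of $\theta$ there is an immediate subtree $\theta^\sharp_{[j]}$ of $\theta^\sharp$ with $\theta_{[i]}\propto\theta^\sharp_{[j]}$. **Theorem.** Let $\theta\in\Theta$ and $\theta^\sharp\in\Theta^\sharp$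 be such that $\theta(\epsilon)=(\rho\vdash_\beta N\to\eta)$ for some $\eta$ or $\theta(\epsilon)=(\rho\vdash_\beta N\stackrel{\infty}{\to})$, and $\theta^\sharp(\epsilon)=(\rho\vdash_\beta N^\sharp\to\eta^\sharp)$, where $N\propto N^\sharp$. Then $\theta\propto\theta^\sharp$. -/

import Mathlib

universe u

namespace CPM

/-! ## Syntax -/

/-- Identifiers: `main`, `x`, `x₀`, `x₁`, … and the reserved identifiers (underlined `x`,
`x₀`, `x₁`, …); `rxn n` is the reserved identifier with index `n`. -/
inductive Ident : Type
  | main | base | idx (n : ℕ) | rbase | rxn (n : ℕ)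
  deriving DecidableEq

/-- Storable types (these are the basic types). -/
inductive SType : Type
  | integer | boolean
  deriving DecidableEq

/-- Run-time system exceptions. The set is open: `Ext` contains the further exceptions. -/
inductive RTSExcept (Ext : Type u) : Type u
  | divbyzero | stkovflw | datovflw | memerror | other (c : Ext)

/-- Constants, which are also the storable values. -/
inductive SVal : Type
  | int (m : ℤ) | bool (t : Bool)

def SVal.type : SVal → SType
  | .int _ => .integer
  | .bool _ => .boolean

/-- Exceptions: RTS exceptions and storable values. -/
inductive Exc (Ext : Type u) : Type u
  | rts (χ : RTSExcept Ext) | val (v : SVal)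

/-- Catchable types. -/
inductive CType : Type
  | rts | st (sT : SType)

def Exc.type {Ext : Type u} : Exc Ext → CType
  | .rts _ => .rts
  | .val v => .st v.type

/-- Exception declarations: `χ`, `cT`, `id : sT` and `any`. -/
inductive ExcDecl (Ext : Type u) : Type u
  | rts (χ : RTSExcept Ext) | ty (cT : CType) | var (id : Ident) (sT : SType) | any

inductive ArithOp : Type
  | add | sub | mul | div | mod

inductive TestOp : Type
  | eq | ne | lt | le | ge | gt

inductive Exp : Type
  | con (c : SVal)
  | neg (e : Exp)
  | arith (op : ArithOp) (e₀ e₁ : Exp)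
  | test (op : TestOp) (e₀ e₁ : Exp)
  | not (e : Exp)
  | and (e₀ e₁ : Exp)
  | or (e₀ e₁ : Exp)
  | var (id : Ident)

abbrev FormParams : Type := List (Ident × SType)

/-- Addresses: absolute locations and indirect (stack) locators. -/
inductive Addr (Loc : Type u) : Type u
  | loc (l : Loc) | ind (i : ℕ)

mutual
/-- Denotable values: typed addresses and closures `λ fps . body`. -/
inductive DVal (Loc Ext : Type u) : Type u
  | loc (a : Addr Loc) (sT : SType)
  | clo (fps : FormParams) (body : Body Loc Ext)

inductive Body (Loc Ext : Type u) : Type u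
  | letIn (d : Decl Loc Ext) (s : Stmt Loc Ext) (e : Exp)
  | external (sT : SType)

/-- Local declarations, including the (recursive) execution environments that occur in
closures; an environment is a function from a finite set of identifiers. -/
inductive Decl (Loc Ext : Type u) : Type u
  | nil
  | lvar (id : Ident) (sT : SType) (e : Exp)
  | seq (d₀ d₁ : Decl Loc Ext)
  | env (I : Finset Ident) (ρ : {x // x ∈ I} → DVal Loc Ext)
  | recEnv (I : Finset Ident) (ρ : {x // x ∈ I} → DVal Loc Ext)

inductive Stmt (Loc Ext : Type u) : Type u
  | nop
  | assign (id : Ident) (e : Exp)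
  | call (id₀ id : Ident) (es : List Exp)
  | seq (s₀ s₁ : Stmt Loc Ext)
  | block (d : Decl Loc Ext) (s : Stmt Loc Ext)
  | ite (e : Exp) (s₀ s₁ : Stmt Loc Ext)
  | whileDo (e : Exp) (s : Stmt Loc Ext)
  | throwRts (χ : RTSExcept Ext)
  | throwExp (e : Exp)
  | tryCatch (s : Stmt Loc Ext) (k : Catch Loc Ext)
  | tryFinally (s₀ s₁ : Stmt Loc Ext)

inductive Catch (Loc Ext : Type u) : Type u
  | clause (p : ExcDecl Ext) (s : Stmt Loc Ext)
  | seq (k₀ k₁ : Catch Loc Ext)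
end

inductive Glob (Loc Ext : Type u) : Type u
  | gvar (id : Ident) (sT : SType) (e : Exp)
  | function (id : Ident) (fps : FormParams) (body : Body Loc Ext)
  | recG (g : Glob Loc Ext)
  | seq (g₀ g₁ : Glob Loc Ext)

/-! ## Finite partial functions on identifiers -/

structure FMap (V : Type u) : Type u where
  dom : Finset Ident
  val : {x // x ∈ dom} → V

namespace FMap
variable {V : Type u}

def get? (m : FMap V) (x : Ident) : Option V :=
  if h : x ∈ m.dom then some (m.val ⟨x, h⟩) else none

/-- The restriction to `I` of the partial function `f`. -/
def ofFun (I : Finset Ident) (f : Ident → Option V) : FMap V where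
  dom := I.filter fun x => (f x).isSome
  val x := (f x.1).get (Finset.mem_filter.mp x.2).2

def empty : FMap V := ofFun ∅ fun _ => none

def single (x : Ident) (v : V) : FMap V := ofFun {x} fun _ => some v

/-- The update `f₀[f₁]`. -/
def update (f₀ f₁ : FMap V) : FMap V :=
  ofFun (f₀.dom ∪ f₁.dom) fun x => if x ∈ f₁.dom then f₁.get? x else f₀.get? x

def restrict (f : FMap V) (I : Finset Ident) : FMap V := ofFun I f.get?

/-- The restriction of `f` to the complement of `I`. -/
def without (f : FMap V) (I : Finset Ident) : FMap V := ofFun (f.dom \ I) f.get?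

theorem get?_ofFun (I : Finset Ident) (f : Ident → Option V) (x : Ident) :
    (ofFun I f).get? x = if x ∈ I then f x else none := by
  unfold get? ofFun
  by_cases hI : x ∈ I
  · cases hf : f x <;> simp [hI, hf]
  · simp [hI]

theorem get?_update (f₀ f₁ : FMap V) (x : Ident) :
    (f₀.update f₁).get? x = if x ∈ f₁.dom then f₁.get? x else f₀.get? x := by
  unfold update
  rw [get?_ofFun]
  by_cases h₁ : x ∈ f₁.dom
  · simp [h₁]
  · by_cases h₀ : x ∈ f₀.dom
    · simp [h₁, h₀]
    · simp [h₁, h₀, get?]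

theorem get?_inj {f g : FMap V} (h : ∀ x, f.get? x = g.get? x) : f = g := by
  obtain ⟨I, f⟩ := f
  obtain ⟨J, g⟩ := g
  have hIJ : I = J := by
    ext x
    have hx := h x
    by_cases hI : x ∈ I <;> by_cases hJ : x ∈ J <;> simp_all [get?]
  subst hIJ
  congr 1
  funext x
  have hx := h x.1
  simpa [get?, x.2] using hx

end FMap

/-- Execution environments. -/
abbrev Env (Loc Ext : Type u) : Type u := FMap (DVal Loc Ext)

def Env.toDecl {Loc Ext : Type u} (ρ : Env Loc Ext) : Decl Loc Ext := .env ρ.dom ρ.val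

def Env.toRecDecl {Loc Ext : Type u} (ρ : Env Loc Ext) : Decl Loc Ext := .recEnv ρ.dom ρ.val

/-- Denotable types. -/
inductive DType : Type
  | loc (sT : SType)
  | fn (fps : FormParams) (sT : SType)

/-- Type environments. -/
abbrev TEnv : Type := FMap DType

/-! ## Defined and free identifiers -/

def diFps (fps : FormParams) : Finset Ident := (fps.map Prod.fst).toFinset

def Exp.FI : Exp → Finset Ident
  | .con _ => ∅
  | .neg e => e.FI
  | .arith _ e₀ e₁ => e₀.FI ∪ e₁.FI
  | .test _ e₀ e₁ => e₀.FI ∪ e₁.FI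
  | .not e => e.FI
  | .and e₀ e₁ => e₀.FI ∪ e₁.FI
  | .or e₀ e₁ => e₀.FI ∪ e₁.FI
  | .var id => {id}

def fiExps (es : List Exp) : Finset Ident := es.foldr (fun e I => e.FI ∪ I) ∅

section Identifiers
variable {Loc Ext : Type u}

def ExcDecl.DI : ExcDecl Ext → Finset Ident
  | .var id _ => {id}
  | _ => ∅

def Decl.DI : Decl Loc Ext → Finset Ident
  | .nil => ∅
  | .lvar id _ _ => {id}
  | .seq d₀ d₁ => d₀.DI ∪ d₁.DI
  | .env I _ => I
  | .recEnv I _ => I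

mutual
def DVal.FI : DVal Loc Ext → Finset Ident
  | .loc _ _ => ∅
  | .clo fps body => body.FI \ diFps fps

def Body.FI : Body Loc Ext → Finset Ident
  | .letIn d s e => d.FI ∪ (s.FI \ d.DI) ∪ (e.FI \ d.DI)
  | .external _ => ∅

def Decl.FI : Decl Loc Ext → Finset Ident
  | .nil => ∅
  | .lvar _ _ e => e.FI
  | .seq d₀ d₁ => d₀.FI ∪ (d₁.FI \ d₀.DI)
  | .env I ρ => I.attach.biUnion fun x => (ρ x).FI
  | .recEnv I ρ => (I.attach.biUnion fun x => (ρ x).FI) \ I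

def Stmt.FI : Stmt Loc Ext → Finset Ident
  | .nop => ∅
  | .assign id e => {id} ∪ e.FI
  | .call id₀ id es => {id, id₀} ∪ fiExps es
  | .seq s₀ s₁ => s₀.FI ∪ s₁.FI
  | .block d s => d.FI ∪ (s.FI \ d.DI)
  | .ite e s₀ s₁ => e.FI ∪ s₀.FI ∪ s₁.FI
  | .whileDo e s => e.FI ∪ s.FI
  | .throwRts _ => ∅
  | .throwExp e => e.FI
  | .tryCatch s k => s.FI ∪ k.FI
  | .tryFinally s₀ s₁ => s₀.FI ∪ s₁.FI

def Catch.FI : Catch Loc Ext → Finset Ident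
  | .clause p s => s.FI \ p.DI
  | .seq k₀ k₁ => k₀.FI ∪ k₁.FI
end

def Glob.DI : Glob Loc Ext → Finset Ident
  | .gvar id _ _ => {id}
  | .function id _ _ => {id}
  | .recG g => g.DI
  | .seq g₀ g₁ => g₀.DI ∪ g₁.DI

def Glob.FI : Glob Loc Ext → Finset Ident
  | .gvar _ _ e => e.FI
  | .function _ fps body => body.FI \ diFps fps
  | .recG g => g.FI \ g.DI
  | .seq g₀ g₁ => g₀.FI ∪ (g₁.FI \ g₀.DI)

end Identifiers

/-! ## Static semantics -/

/-- `β ⊢ e : sT`. -/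
inductive ExpTy (β : TEnv) : Exp → SType → Prop
  | con {c} : ExpTy β (.con c) c.type
  | neg {e} : ExpTy β e .integer → ExpTy β (.neg e) .integer
  | not {e} : ExpTy β e .boolean → ExpTy β (.not e) .boolean
  | arith {op e₀ e₁} : ExpTy β e₀ .integer → ExpTy β e₁ .integer →
      ExpTy β (.arith op e₀ e₁) .integer
  | test {op e₀ e₁} : ExpTy β e₀ .integer → ExpTy β e₁ .integer →
      ExpTy β (.test op e₀ e₁) .boolean
  | and {e₀ e₁} : ExpTy β e₀ .boolean → ExpTy β e₁ .boolean → ExpTy β (.and e₀ e₁) .boolean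
  | or {e₀ e₁} : ExpTy β e₀ .boolean → ExpTy β e₁ .boolean → ExpTy β (.or e₀ e₁) .boolean
  | var {id sT} : β.get? id = some (.loc sT) → ExpTy β (.var id) sT

/-- `β, fps ⊢ es`. -/
inductive ExpsTy (β : TEnv) : FormParams → List Exp → Prop
  | nil : ExpsTy β [] []
  | cons {id sT fps e es} : ExpTy β e sT → ExpsTy β fps es →
      ExpsTy β ((id, sT) :: fps) (e :: es)

/-- `fps : δ`. -/
inductive FpsTy : FormParams → TEnv → Prop
  | nil : FpsTy [] .empty
  | cons {id sT fps δ} : FpsTy fps δ → id ∉ diFps fps →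
      FpsTy ((id, sT) :: fps) ((FMap.single id (.loc sT)).update δ)

/-- `⊢ p : δ`. -/
inductive ExcDeclTy {Ext : Type u} : ExcDecl Ext → TEnv → Prop
  | rts {χ} : ExcDeclTy (.rts χ) .empty
  | ty {cT} : ExcDeclTy (.ty cT) .empty
  | var {id sT} : ExcDeclTy (.var id sT) (.single id (.loc sT))
  | any : ExcDeclTy .any .empty

section Static
variable {Loc Ext : Type u}

mutual
/-- The value `v` bound in an environment of type `β` has the denotable type `τ`. The body of
a closure is checked with the formal parameters in scope. -/
inductive DValTy : TEnv → DVal Loc Ext → DType → Prop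
  | loc {β a sT} : DValTy β (.loc a sT) (.loc sT)
  | clo {β fps δ body sT} : FpsTy fps δ → BodyTy (β.update δ) body sT →
      DValTy β (.clo fps body) (.fn fps sT)

/-- `ρ : β`. -/
inductive EnvTy : Env Loc Ext → TEnv → Prop
  | mk {ρ : Env Loc Ext} {β : TEnv} : ρ.dom = β.dom →
      (∀ id v τ, ρ.get? id = some v → β.get? id = some τ → DValTy β v τ) → EnvTy ρ β

/-- `β ⊢ body : sT`. -/
inductive BodyTy : TEnv → Body Loc Ext → SType → Prop
  | letIn {β β₀ d s e sT} : DeclTy β d β₀ → StmtTy (β.update β₀) s → ExpTy (β.update β₀) e sT →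
      BodyTy β (.letIn d s e) sT
  | external {β sT} : BodyTy β (.external sT) sT

/-- `β ⊢ d : δ`. -/
inductive DeclTy : TEnv → Decl Loc Ext → TEnv → Prop
  | nil {β} : DeclTy β .nil .empty
  | lvar {β id sT e} : ExpTy β e sT → DeclTy β (.lvar id sT e) (.single id (.loc sT))
  | seq {β β₀ β₁ d₀ d₁} : DeclTy β d₀ β₀ → DeclTy (β.update β₀) d₁ β₁ →
      DeclTy β (.seq d₀ d₁) (β₀.update β₁)
  | env {β δ I ρ} : EnvTy ⟨I, ρ⟩ δ → DeclTy β (.env I ρ) δ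
  | recEnv {β δ I ρ} : DeclTy (β.update (δ.restrict ((Decl.env I ρ).FI ∩ I))) (.env I ρ) δ →
      (∀ id sT, δ.get? id ≠ some (.loc sT)) → DeclTy β (.recEnv I ρ) δ

/-- `β ⊢ s`. -/
inductive StmtTy : TEnv → Stmt Loc Ext → Prop
  | nop {β} : StmtTy β .nop
  | assign {β id e sT} : ExpTy β e sT → β.get? id = some (.loc sT) → StmtTy β (.assign id e)
  | call {β id₀ id es fps sT} : ExpsTy β fps es → β.get? id₀ = some (.loc sT) →
      β.get? id = some (.fn fps sT) → StmtTy β (.call id₀ id es)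
  | seq {β s₀ s₁} : StmtTy β s₀ → StmtTy β s₁ → StmtTy β (.seq s₀ s₁)
  | block {β β₀ d s} : DeclTy β d β₀ → StmtTy (β.update β₀) s → StmtTy β (.block d s)
  | ite {β e s₀ s₁} : ExpTy β e .boolean → StmtTy β s₀ → StmtTy β s₁ → StmtTy β (.ite e s₀ s₁)
  | whileDo {β e s} : ExpTy β e .boolean → StmtTy β s → StmtTy β (.whileDo e s)
  | throwRts {β χ} : StmtTy β (.throwRts χ)
  | throwExp {β e sT} : ExpTy β e sT → StmtTy β (.throwExp e)
  | tryCatch {β s k} : StmtTy β s → CatchTy β k → StmtTy β (.tryCatch s k)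
  | tryFinally {β s₀ s₁} : StmtTy β s₀ → StmtTy β s₁ → StmtTy β (.tryFinally s₀ s₁)

/-- `β ⊢ k`. -/
inductive CatchTy : TEnv → Catch Loc Ext → Prop
  | clause {β δ p s} : ExcDeclTy p δ → StmtTy (β.update δ) s → CatchTy β (.clause p s)
  | seq {β k₀ k₁} : CatchTy β k₀ → CatchTy β k₁ → CatchTy β (.seq k₀ k₁)
end

/-- `β ⊢ g : δ`. -/
inductive GlobTy : TEnv → Glob Loc Ext → TEnv → Prop
  | gvar {β id sT e} : ExpTy β e sT → GlobTy β (.gvar id sT e) (.single id (.loc sT))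
  | function {β δ id fps body sT} : FpsTy fps δ → BodyTy (β.update δ) body sT →
      GlobTy β (.function id fps body) (.single id (.fn fps sT))
  | recG {β δ g} : GlobTy (β.update (δ.restrict (g.FI ∩ g.DI))) g δ →
      (∀ id sT, δ.get? id ≠ some (.loc sT)) → GlobTy β (.recG g) δ
  | seq {β β₀ β₁ g₀ g₁} : GlobTy β g₀ β₀ → GlobTy (β.update β₀) g₁ β₁ →
      GlobTy β (.seq g₀ g₁) (β₀.update β₁)

/-- The requirement on the environments of sequents: if `J` is the domain of `ρ`, then `J` is
contained in the domain of `β` and `ρ` has type `β` restricted to `J`. -/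
def Compat (ρ : Env Loc Ext) (β : TEnv) : Prop := EnvTy ρ (β.restrict ρ.dom)

end Static

/-! ## Memory structures -/

/-- Stack symbols: locations, the stack marker `†` and the frame marker `‡`. -/
inductive StkSym (Loc : Type u) : Type u
  | loc (l : Loc) | dag | ddag

def StkSym.loc? {Loc : Type u} : StkSym Loc → Option Loc
  | .loc l => some l
  | _ => none

def StkSym.notFrame {Loc : Type u} : StkSym Loc → Bool
  | .ddag => false
  | _ => true

/-- Stacks: words (the top is on the right) in which no location occurs more than once. -/
def Stack (Loc : Type u) : Type u :=
  {w : List (StkSym Loc) // (w.filterMap StkSym.loc?).Nodup}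

/-- Absolute maps. -/
abbrev AMap (Loc : Type u) : Type u := Loc × SType → Option SVal

abbrev Mem (Loc : Type u) : Type u := AMap Loc × Stack Loc

abbrev ValState (Loc : Type u) : Type u := SVal × Mem Loc

abbrev ExcState (Loc Ext : Type u) : Type u := Mem Loc × Exc Ext

section Memory
variable {Loc Ext : Type u}

/-- The top-most frame: the longest suffix without frame markers. -/
def topFrame (w : Stack Loc) : List (StkSym Loc) := w.1.rtakeWhile StkSym.notFrame

/-- `σ @ a`. -/
def Mem.at (σ : Mem Loc) : Addr Loc → Option Loc
  | .loc l => some l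
  | .ind i => (topFrame σ.2)[i]?.bind StkSym.loc?

/-- The read operator `σ[a, sT]`. -/
def Mem.read (σ : Mem Loc) (a : Addr Loc) (sT : SType) : ValState Loc ⊕ ExcState Loc Ext :=
  match (Mem.at σ a).bind fun l => σ.1 (l, sT) with
  | some v => .inl (v, σ)
  | none => .inr (σ, .rts .memerror)

/-- The conditions on the location `l` and the absolute map `μ'` obtained from `μ` by
allocating a new cell that holds `v`. -/
def Allocates (μ μ' : AMap Loc) (l : Loc) (v : SVal) : Prop :=
  (∀ sT, μ (l, sT) = none) ∧ (∀ d, (μ d).isSome → μ' d = μ d) ∧ μ' (l, v.type) = some v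

/-- The language leaves the update of absolute maps, the overflow conditions and the choice of
new locations to the implementation, which may be nondeterministic. `Upd μ d v μ'` means that
`μ'` is a possible result of the update `μ[d := v]`; `AllocD υ (σ, l)` means that `(σ, l)` is a
possible result of allocating the value state `υ` in the data segment, and `FullD υ` that the
data segment possibly cannot be extended; likewise `AllocS` and `FullS` for the stack segment. -/
structure MemImpl (Loc : Type u) : Type u where
  Upd : AMap Loc → Loc × SType → SVal → AMap Loc → Prop
  upd_total : ∀ μ d v, (μ d).isSome → v.type = d.2 → ∃ μ', Upd μ d v μ'
  upd_spec : ∀ μ d v μ', (μ d).isSome → v.type = d.2 → Upd μ d v μ' →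
    (∀ d', (μ' d').isSome ↔ (μ d').isSome) ∧ μ' d = some v ∧
      ∀ d', (μ d').isSome → d'.1 ≠ d.1 → μ' d' = μ d'
  AllocD : ValState Loc → Mem Loc × Loc → Prop
  FullD : ValState Loc → Prop
  allocD_total : ∀ υ, FullD υ ∨ ∃ r, AllocD υ r
  allocD_spec : ∀ v σ σ' l, AllocD (v, σ) (σ', l) → σ'.2 = σ.2 ∧ Allocates σ.1 σ'.1 l v
  AllocS : ValState Loc → Mem Loc × Loc → Prop
  FullS : ValState Loc → Prop
  allocS_total : ∀ υ, FullS υ ∨ ∃ r, AllocS υ r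
  allocS_spec : ∀ v σ σ' l, AllocS (v, σ) (σ', l) →
    σ'.2.1 = σ.2.1 ++ [.loc l] ∧ Allocates σ.1 σ'.1 l v

/-- The update operator: `η` is a possible result of `σ[(a, sT) := v]`. -/
def MemImpl.Write (M : MemImpl Loc) (σ : Mem Loc) (a : Addr Loc) (sT : SType) (v : SVal) :
    Mem Loc ⊕ ExcState Loc Ext → Prop
  | .inl σ' => ∃ l, Mem.at σ a = some l ∧ (σ.1 (l, sT)).isSome ∧ v.type = sT ∧
      M.Upd σ.1 (l, sT) v σ'.1 ∧ σ'.2 = σ.2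
  | .inr ε => (¬ ∃ l, Mem.at σ a = some l ∧ (σ.1 (l, sT)).isSome ∧ v.type = sT) ∧
      ε = (σ, .rts .memerror)

/-- `r` is a possible result of the data allocation function on `υ`. -/
def MemImpl.NewD (M : MemImpl Loc) (υ : ValState Loc) :
    (Mem Loc × Loc) ⊕ ExcState Loc Ext → Prop
  | .inl r => M.AllocD υ r
  | .inr ε => M.FullD υ ∧ ε = (υ.2, .rts .datovflw)

/-- `r` is a possible result of the stack allocation function on `υ`; the indirect locator of
the new location is the length of the top-most frame. -/
def MemImpl.NewS (M : MemImpl Loc) (υ : ValState Loc) : (Mem Loc × ℕ) ⊕ ExcState Loc Ext → Prop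
  | .inl r => (∃ l, M.AllocS υ (r.1, l)) ∧ r.2 = (topFrame υ.2.2).length
  | .inr ε => M.FullS υ ∧ ε = (υ.2, .rts .stkovflw)

def cleanupD (ε : ExcState Loc Ext) : ExcState Loc Ext :=
  ((fun _ => none, ⟨[], List.nodup_nil⟩), ε.2)

def markS (σ : Mem Loc) : Mem Loc :=
  (σ.1, ⟨σ.2.1 ++ [.dag], by
    rw [List.filterMap_append]; exact (List.append_nil _).symm ▸ σ.2.property⟩)

/-- The graph of the partial function that unmarks the stack. -/
def UnmarkS (σ σ' : Mem Loc) : Prop :=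
  ∃ w : List Loc, σ.2.1 = σ'.2.1 ++ .dag :: w.map .loc ∧
    ∀ d, (d.1 ∈ w → σ'.1 d = none) ∧ (d.1 ∉ w → σ'.1 d = σ.1 d)

/-- The graph of the frame link partial function. -/
def LinkS (σ σ' : Mem Loc) : Prop :=
  σ'.1 = σ.1 ∧ ∃ (w' : List (StkSym Loc)) (w : List Loc),
    σ.2.1 = w' ++ .dag :: w.map .loc ∧ σ'.2.1 = w' ++ .ddag :: w.map .loc

/-- The graph of the frame unlink partial function. -/
def UnlinkS (σ σ' : Mem Loc) : Prop :=
  σ'.1 = σ.1 ∧ ∃ (w' : List (StkSym Loc)) (w : List Loc),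
    σ.2.1 = w' ++ .ddag :: w.map .loc ∧ σ'.2.1 = w' ++ .dag :: w.map .loc

def UnmarkE (ε ε' : ExcState Loc Ext) : Prop := UnmarkS ε.1 ε'.1 ∧ ε'.2 = ε.2

def UnlinkE (ε ε' : ExcState Loc Ext) : Prop := UnlinkS ε.1 ε'.1 ∧ ε'.2 = ε.2

/-- Unmarking, on the terminal configurations of statements. -/
def UnmarkT : Mem Loc ⊕ ExcState Loc Ext → Mem Loc ⊕ ExcState Loc Ext → Prop :=
  Sum.LiftRel UnmarkS UnmarkE

end Memory

/-! ## Configurations and sequents -/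

/-- Kinds of configurations: expressions, local and global declarations, statements, function
bodies and catch clauses. -/
inductive Kind : Type
  | e | d | g | s | b | k

/-- Only statements, function bodies and catch clauses may diverge. -/
def Kind.MayDiverge : Kind → Prop
  | .e | .d | .g => False
  | .s | .b | .k => True

/-- The constructs of each kind. -/
@[reducible] def Con (Loc Ext : Type u) : Kind → Type u
  | .e => ULift.{u} Exp
  | .d => Decl Loc Ext
  | .g => Glob Loc Ext
  | .s => Stmt Loc Ext
  | .b => Body Loc Ext
  | .k => Catch Loc Ext

/-- The state component of non-terminal configurations. -/
@[reducible] def InSt (Loc Ext : Type u) : Kind → Type u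
  | .e | .d | .g | .s | .b => Mem Loc
  | .k => ExcState Loc Ext

/-- Non-terminal configurations (before typing is taken into account). -/
abbrev NT (Loc Ext : Type u) (q : Kind) : Type u := Con Loc Ext q × InSt Loc Ext q

/-- Terminal configurations; for catch clauses, `inl` is `caught` and `inr` is `uncaught`. -/
@[reducible] def Tm (Loc Ext : Type u) : Kind → Type u
  | .e => ValState Loc ⊕ ExcState Loc Ext
  | .d | .g => (Env Loc Ext × Mem Loc) ⊕ ExcState Loc Ext
  | .s | .b => Mem Loc ⊕ ExcState Loc Ext
  | .k => (Mem Loc ⊕ ExcState Loc Ext) ⊕ ExcState Loc Ext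

/-- Concrete sequents: `pos q ρ β N η` is `ρ ⊢_β N → η`, and `neg q ρ β N` is the divergence
sequent `ρ ⊢_β N →∞`. -/
inductive Sequent (Loc Ext : Type u) : Type u
  | pos (q : Kind) (ρ : Env Loc Ext) (β : TEnv) (N : NT Loc Ext q) (η : Tm Loc Ext q)
  | neg (q : Kind) (ρ : Env Loc Ext) (β : TEnv) (N : NT Loc Ext q)

section Configurations
variable {Loc Ext : Type u}

/-- The construct `c` of kind `q` is well typed in `β`. -/
def WellTyped (β : TEnv) : (q : Kind) → Con Loc Ext q → Prop
  | .e, c => ∃ sT, ExpTy β c.down sT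
  | .d, c => ∃ δ, DeclTy β c δ
  | .g, c => ∃ δ, GlobTy β c δ
  | .s, c => StmtTy β c
  | .b, c => ∃ sT, BodyTy β c sT
  | .k, c => CatchTy β c

/-- The conditions that all sequents have to satisfy: the environment is compatible with the
type environment, and the non-terminal configuration is well typed. -/
def Sequent.WF : Sequent Loc Ext → Prop
  | .pos q ρ β N _ => Compat ρ β ∧ WellTyped β q N.1
  | .neg q ρ β N => Compat ρ β ∧ WellTyped β q N.1

abbrev evE (ρ : Env Loc Ext) (β : TEnv) (e : Exp) (σ : Mem Loc)
    (η : ValState Loc ⊕ ExcState Loc Ext) : Sequent Loc Ext := .pos .e ρ β (⟨e⟩, σ) η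

abbrev evD (ρ : Env Loc Ext) (β : TEnv) (d : Decl Loc Ext) (σ : Mem Loc)
    (η : (Env Loc Ext × Mem Loc) ⊕ ExcState Loc Ext) : Sequent Loc Ext := .pos .d ρ β (d, σ) η

abbrev evG (ρ : Env Loc Ext) (β : TEnv) (g : Glob Loc Ext) (σ : Mem Loc)
    (η : (Env Loc Ext × Mem Loc) ⊕ ExcState Loc Ext) : Sequent Loc Ext := .pos .g ρ β (g, σ) η

abbrev evS (ρ : Env Loc Ext) (β : TEnv) (s : Stmt Loc Ext) (σ : Mem Loc)
    (η : Mem Loc ⊕ ExcState Loc Ext) : Sequent Loc Ext := .pos .s ρ β (s, σ) η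

abbrev evB (ρ : Env Loc Ext) (β : TEnv) (b : Body Loc Ext) (σ : Mem Loc)
    (η : Mem Loc ⊕ ExcState Loc Ext) : Sequent Loc Ext := .pos .b ρ β (b, σ) η

abbrev evK (ρ : Env Loc Ext) (β : TEnv) (k : Catch Loc Ext) (ε : ExcState Loc Ext)
    (η : (Mem Loc ⊕ ExcState Loc Ext) ⊕ ExcState Loc Ext) : Sequent Loc Ext :=
  .pos .k ρ β (k, ε) η

end Configurations

/-! ## Concrete rules -/

def ArithOp.eval : ArithOp → ℤ → ℤ → ℤ
  | .add => fun m₀ m₁ => m₀ + m₁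
  | .sub => fun m₀ m₁ => m₀ - m₁
  | .mul => fun m₀ m₁ => m₀ * m₁
  | .div => fun m₀ m₁ => m₀.tdiv m₁
  | .mod => fun m₀ m₁ => m₀.tmod m₁

def ArithOp.IsDiv : ArithOp → Prop
  | .add | .sub | .mul => False
  | .div | .mod => True

def TestOp.eval : TestOp → ℤ → ℤ → Bool
  | .eq => fun m₀ m₁ => decide (m₀ = m₁)
  | .ne => fun m₀ m₁ => decide (m₀ ≠ m₁)
  | .lt => fun m₀ m₁ => decide (m₀ < m₁)
  | .le => fun m₀ m₁ => decide (m₀ ≤ m₁)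
  | .ge => fun m₀ m₁ => decide (m₀ ≥ m₁)
  | .gt => fun m₀ m₁ => decide (m₀ > m₁)

section Auxiliary
variable {Loc Ext : Type u}

/-- `d; lvar rxₙ : sT = e; lvar rxₙ₊₁ : sT' = e'; …` -/
def argDecl (d : Decl Loc Ext) (n : ℕ) : FormParams → List Exp → Decl Loc Ext
  | (_, sT) :: fps, e :: es => .seq d (argDecl (.lvar (.rxn n) sT e) (n + 1) fps es)
  | _, _ => d

/-- The declaration `lvar rx₀ : sT₀ = id₀; lvar rx₁ : sT₁ = e₁; …; lvar rxₙ : sTₙ = eₙ` that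
evaluates the actual parameters of a function call. -/
def callDecl (id₀ : Ident) (sT₀ : SType) (fps : FormParams) (es : List Exp) : Decl Loc Ext :=
  argDecl (.lvar (.rxn 0) sT₀ (.var id₀)) 1 fps es

/-- The environment mapping the `j`-th formal parameter to the indirect locator `n + j`. -/
def paramEnv (n : ℕ) : FormParams → Env Loc Ext
  | [] => .empty
  | (id, sT) :: fps => (paramEnv (n + 1) fps).update (.single id (.loc (.ind n) sT))

/-- The environment of the callee: `rx₀ ↦ (0, sT₀)` and the parameters `idⱼ ↦ (j, sTⱼ)`. -/
def calleeEnv (sT₀ : SType) (fps : FormParams) : Env Loc Ext :=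
  (FMap.single (.rxn 0) (.loc (.ind 0) sT₀)).update (paramEnv 1 fps)

/-- The environment obtained by evaluating `rec ρ`. -/
def unfoldRec (ρ : Env Loc Ext) : Env Loc Ext :=
  FMap.ofFun ρ.dom fun id =>
    match ρ.get? id with
    | some (.clo fps (.external sT)) => some (.clo fps (.external sT))
    | some (.clo fps (.letIn d s e)) =>
      some (.clo fps (.letIn (.seq (Env.toRecDecl (ρ.without (diFps fps))) d) s e))
    | _ => none

/-- The body of the closure that is built by a function declaration. -/
def closeBody (ρ : Env Loc Ext) (fps : FormParams) : Body Loc Ext → Body Loc Ext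
  | .external sT => .external sT
  | .letIn d s e =>
    .letIn (.seq (Env.toDecl (ρ.restrict ((Body.letIn d s e).FI \ diFps fps))) d) s e

/-- The exceptions that are caught by an exception declaration. -/
def ExcDecl.Matches : ExcDecl Ext → Exc Ext → Prop
  | .any, _ => True
  | .rts χ, ξ => ξ = .rts χ
  | .ty cT, ξ => ξ.type = cT
  | .var _ sT, ξ => ξ.type = .st sT

def ExcDecl.IsVar : ExcDecl Ext → Prop
  | .var _ _ => True
  | _ => False

end Auxiliary

section ConcreteRules
variable {Loc Ext : Type u}

/-- The concrete rule schemata. -/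
inductive PosRule (M : MemImpl Loc) : List (Sequent Loc Ext) → Sequent Loc Ext → Prop
  -- expressions
  | con {ρ β c σ} : PosRule M [] (evE ρ β (.con c) σ (.inl (c, σ)))
  | var {ρ β id σ a sT} : FMap.get? ρ id = some (.loc a sT) →
      PosRule M [] (evE ρ β (.var id) σ (Mem.read σ a sT))
  | neg_err {ρ β e σ ε} :
      PosRule M [evE ρ β e σ (.inr ε)] (evE ρ β (.neg e) σ (.inr ε))
  | neg_ok {ρ β e σ m σ₀} :
      PosRule M [evE ρ β e σ (.inl (.int m, σ₀))] (evE ρ β (.neg e) σ (.inl (.int (-m), σ₀)))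
  | arith_err₀ {ρ β op e₀ e₁ σ ε} :
      PosRule M [evE ρ β e₀ σ (.inr ε)] (evE ρ β (.arith op e₀ e₁) σ (.inr ε))
  | arith_err₁ {ρ β op e₀ e₁ σ m₀ σ₀ ε} :
      PosRule M [evE ρ β e₀ σ (.inl (.int m₀, σ₀)), evE ρ β e₁ σ₀ (.inr ε)]
        (evE ρ β (.arith op e₀ e₁) σ (.inr ε))
  | arith_ok {ρ β op e₀ e₁ σ m₀ σ₀ m₁ σ₁} : (¬ op.IsDiv ∨ m₁ ≠ 0) →
      PosRule M [evE ρ β e₀ σ (.inl (.int m₀, σ₀)), evE ρ β e₁ σ₀ (.inl (.int m₁, σ₁))]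
        (evE ρ β (.arith op e₀ e₁) σ (.inl (.int (op.eval m₀ m₁), σ₁)))
  | arith_exc {ρ β op e₀ e₁ σ m₀ σ₀ σ₁} : op.IsDiv →
      PosRule M [evE ρ β e₀ σ (.inl (.int m₀, σ₀)), evE ρ β e₁ σ₀ (.inl (.int 0, σ₁))]
        (evE ρ β (.arith op e₀ e₁) σ (.inr (σ₁, .rts .divbyzero)))
  | test_err₀ {ρ β op e₀ e₁ σ ε} :
      PosRule M [evE ρ β e₀ σ (.inr ε)] (evE ρ β (.test op e₀ e₁) σ (.inr ε))
  | test_err₁ {ρ β op e₀ e₁ σ m₀ σ₀ ε} :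
      PosRule M [evE ρ β e₀ σ (.inl (.int m₀, σ₀)), evE ρ β e₁ σ₀ (.inr ε)]
        (evE ρ β (.test op e₀ e₁) σ (.inr ε))
  | test_ok {ρ β op e₀ e₁ σ m₀ σ₀ m₁ σ₁} :
      PosRule M [evE ρ β e₀ σ (.inl (.int m₀, σ₀)), evE ρ β e₁ σ₀ (.inl (.int m₁, σ₁))]
        (evE ρ β (.test op e₀ e₁) σ (.inl (.bool (op.eval m₀ m₁), σ₁)))
  | not_err {ρ β e σ ε} :
      PosRule M [evE ρ β e σ (.inr ε)] (evE ρ β (.not e) σ (.inr ε))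
  | not_ok {ρ β e σ t σ₀} :
      PosRule M [evE ρ β e σ (.inl (.bool t, σ₀))] (evE ρ β (.not e) σ (.inl (.bool (!t), σ₀)))
  | and_err {ρ β e₀ e₁ σ ε} :
      PosRule M [evE ρ β e₀ σ (.inr ε)] (evE ρ β (.and e₀ e₁) σ (.inr ε))
  | and_ff {ρ β e₀ e₁ σ σ₀} :
      PosRule M [evE ρ β e₀ σ (.inl (.bool false, σ₀))]
        (evE ρ β (.and e₀ e₁) σ (.inl (.bool false, σ₀)))
  | and_tt {ρ β e₀ e₁ σ σ₀ η} :
      PosRule M [evE ρ β e₀ σ (.inl (.bool true, σ₀)), evE ρ β e₁ σ₀ η]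
        (evE ρ β (.and e₀ e₁) σ η)
  | or_err {ρ β e₀ e₁ σ ε} :
      PosRule M [evE ρ β e₀ σ (.inr ε)] (evE ρ β (.or e₀ e₁) σ (.inr ε))
  | or_tt {ρ β e₀ e₁ σ σ₀} :
      PosRule M [evE ρ β e₀ σ (.inl (.bool true, σ₀))]
        (evE ρ β (.or e₀ e₁) σ (.inl (.bool true, σ₀)))
  | or_ff {ρ β e₀ e₁ σ σ₀ η} :
      PosRule M [evE ρ β e₀ σ (.inl (.bool false, σ₀)), evE ρ β e₁ σ₀ η]
        (evE ρ β (.or e₀ e₁) σ η)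
  -- declarations
  | nil {ρ β σ} : PosRule M [] (evD ρ β .nil σ (.inl (.empty, σ)))
  | env {ρ β σ} {ρ₀ : Env Loc Ext} :
      PosRule M [] (evD ρ β (Env.toDecl ρ₀) σ (.inl (ρ₀, σ)))
  | recEnv {ρ β σ} {ρ₀ : Env Loc Ext} :
      PosRule M [] (evD ρ β (Env.toRecDecl ρ₀) σ (.inl (unfoldRec ρ₀, σ)))
  | gvar_err {ρ β id sT e σ ε} :
      PosRule M [evE ρ β e σ (.inr ε)] (evG ρ β (.gvar id sT e) σ (.inr (cleanupD ε)))
  | gvar_dat_err {ρ β id sT e σ υ ε} : M.NewD υ (.inr ε) →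
      PosRule M [evE ρ β e σ (.inl υ)] (evG ρ β (.gvar id sT e) σ (.inr (cleanupD ε)))
  | gvar_ok {ρ β id sT e σ υ σ₁ l} : M.NewD (Ext := Ext) υ (.inl (σ₁, l)) →
      PosRule M [evE ρ β e σ (.inl υ)]
        (evG ρ β (.gvar id sT e) σ (.inl (.single id (.loc (.loc l) sT), σ₁)))
  | lvar_err {ρ β id sT e σ ε ε'} : UnmarkE ε ε' →
      PosRule M [evE ρ β e σ (.inr ε)] (evD ρ β (.lvar id sT e) σ (.inr ε'))
  | lvar_stk_err {ρ β id sT e σ υ ε ε'} : M.NewS υ (.inr ε) → UnmarkE ε ε' →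
      PosRule M [evE ρ β e σ (.inl υ)] (evD ρ β (.lvar id sT e) σ (.inr ε'))
  | lvar_ok {ρ β id sT e σ υ σ₁ i} : M.NewS (Ext := Ext) υ (.inl (σ₁, i)) →
      PosRule M [evE ρ β e σ (.inl υ)]
        (evD ρ β (.lvar id sT e) σ (.inl (.single id (.loc (.ind i) sT), σ₁)))
  | function {ρ β id fps body σ} :
      PosRule M []
        (evG ρ β (.function id fps body) σ
          (.inl (.single id (.clo fps (closeBody ρ fps body)), σ)))
  | recG {ρ : Env Loc Ext} {β g σ β₀ ρ₀ σ₀ η} : GlobTy β (.recG g) β₀ →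
      PosRule M
        [evG (ρ.without (g.FI ∩ g.DI)) (β.update (β₀.restrict (g.FI ∩ g.DI))) g σ
          (.inl (ρ₀, σ₀)),
         evD ρ β (Env.toRecDecl ρ₀) σ₀ η]
        (evG ρ β (.recG g) σ η)
  | gseq_err₀ {ρ β g₀ g₁ σ ε} :
      PosRule M [evG ρ β g₀ σ (.inr ε)] (evG ρ β (.seq g₀ g₁) σ (.inr ε))
  | gseq_err₁ {ρ β g₀ g₁ σ β₀ ρ₀ σ₀ ε} : GlobTy β g₀ β₀ →
      PosRule M
        [evG ρ β g₀ σ (.inl (ρ₀, σ₀)), evG (ρ.update ρ₀) (β.update β₀) g₁ σ₀ (.inr ε)]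
        (evG ρ β (.seq g₀ g₁) σ (.inr ε))
  | gseq_ok {ρ β g₀ g₁ σ β₀ ρ₀ σ₀ ρ₁ σ₁} : GlobTy β g₀ β₀ →
      PosRule M
        [evG ρ β g₀ σ (.inl (ρ₀, σ₀)), evG (ρ.update ρ₀) (β.update β₀) g₁ σ₀ (.inl (ρ₁, σ₁))]
        (evG ρ β (.seq g₀ g₁) σ (.inl (ρ₀.update ρ₁, σ₁)))
  | dseq_err₀ {ρ β d₀ d₁ σ ε} :
      PosRule M [evD ρ β d₀ σ (.inr ε)] (evD ρ β (.seq d₀ d₁) σ (.inr ε))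
  | dseq_err₁ {ρ β d₀ d₁ σ β₀ ρ₀ σ₀ ε} : DeclTy β d₀ β₀ →
      PosRule M
        [evD ρ β d₀ σ (.inl (ρ₀, σ₀)), evD (ρ.update ρ₀) (β.update β₀) d₁ σ₀ (.inr ε)]
        (evD ρ β (.seq d₀ d₁) σ (.inr ε))
  | dseq_ok {ρ β d₀ d₁ σ β₀ ρ₀ σ₀ ρ₁ σ₁} : DeclTy β d₀ β₀ →
      PosRule M
        [evD ρ β d₀ σ (.inl (ρ₀, σ₀)), evD (ρ.update ρ₀) (β.update β₀) d₁ σ₀ (.inl (ρ₁, σ₁))]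
        (evD ρ β (.seq d₀ d₁) σ (.inl (ρ₀.update ρ₁, σ₁)))
  -- statements
  | nop {ρ β σ} : PosRule M [] (evS ρ β .nop σ (.inl σ))
  | assign_err {ρ β id e σ ε} :
      PosRule M [evE ρ β e σ (.inr ε)] (evS ρ β (.assign id e) σ (.inr ε))
  | assign_ok {ρ β id e σ v σ₀ a sT η} : FMap.get? ρ id = some (.loc a sT) →
      M.Write σ₀ a sT v η →
      PosRule M [evE ρ β e σ (.inl (v, σ₀))] (evS ρ β (.assign id e) σ η)
  | sseq_err {ρ β s₀ s₁ σ ε} :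
      PosRule M [evS ρ β s₀ σ (.inr ε)] (evS ρ β (.seq s₀ s₁) σ (.inr ε))
  | sseq_ok {ρ β s₀ s₁ σ σ₀ η} :
      PosRule M [evS ρ β s₀ σ (.inl σ₀), evS ρ β s₁ σ₀ η] (evS ρ β (.seq s₀ s₁) σ η)
  | block_err {ρ β d s σ ε} :
      PosRule M [evD ρ β d (markS σ) (.inr ε)] (evS ρ β (.block d s) σ (.inr ε))
  | block_ok {ρ β d s σ β₀ ρ₀ σ₀ η η'} : DeclTy β d β₀ → UnmarkT η η' →
      PosRule M
        [evD ρ β d (markS σ) (.inl (ρ₀, σ₀)), evS (ρ.update ρ₀) (β.update β₀) s σ₀ η]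
        (evS ρ β (.block d s) σ η')
  | ite_err {ρ β e s₀ s₁ σ ε} :
      PosRule M [evE ρ β e σ (.inr ε)] (evS ρ β (.ite e s₀ s₁) σ (.inr ε))
  | ite_tt {ρ β e s₀ s₁ σ σ₀ η} :
      PosRule M [evE ρ β e σ (.inl (.bool true, σ₀)), evS ρ β s₀ σ₀ η]
        (evS ρ β (.ite e s₀ s₁) σ η)
  | ite_ff {ρ β e s₀ s₁ σ σ₀ η} :
      PosRule M [evE ρ β e σ (.inl (.bool false, σ₀)), evS ρ β s₁ σ₀ η]
        (evS ρ β (.ite e s₀ s₁) σ η)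
  | while_guard_err {ρ β e s σ ε} :
      PosRule M [evE ρ β e σ (.inr ε)] (evS ρ β (.whileDo e s) σ (.inr ε))
  | while_ff {ρ β e s σ σ₀} :
      PosRule M [evE ρ β e σ (.inl (.bool false, σ₀))] (evS ρ β (.whileDo e s) σ (.inl σ₀))
  | while_body_err {ρ β e s σ σ₀ ε} :
      PosRule M [evE ρ β e σ (.inl (.bool true, σ₀)), evS ρ β s σ₀ (.inr ε)]
        (evS ρ β (.whileDo e s) σ (.inr ε))
  | while_body_ok {ρ β e s σ σ₀ σ₁ η} :
      PosRule M
        [evE ρ β e σ (.inl (.bool true, σ₀)), evS ρ β s σ₀ (.inl σ₁),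
         evS ρ β (.whileDo e s) σ₁ η]
        (evS ρ β (.whileDo e s) σ η)
  | throwRts {ρ β χ σ} : PosRule M [] (evS ρ β (.throwRts χ) σ (.inr (σ, .rts χ)))
  | throw_err {ρ β e σ ε} :
      PosRule M [evE ρ β e σ (.inr ε)] (evS ρ β (.throwExp e) σ (.inr ε))
  | throw_ok {ρ β e σ v σ₀} :
      PosRule M [evE ρ β e σ (.inl (v, σ₀))] (evS ρ β (.throwExp e) σ (.inr (σ₀, .val v)))
  | try_ok {ρ β s k σ σ₀} :
      PosRule M [evS ρ β s σ (.inl σ₀)] (evS ρ β (.tryCatch s k) σ (.inl σ₀))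
  | try_caught {ρ β s k σ ε₀ η} :
      PosRule M [evS ρ β s σ (.inr ε₀), evK ρ β k ε₀ (.inl η)] (evS ρ β (.tryCatch s k) σ η)
  | try_uncaught {ρ β s k σ ε₀ ε} :
      PosRule M [evS ρ β s σ (.inr ε₀), evK ρ β k ε₀ (.inr ε)]
        (evS ρ β (.tryCatch s k) σ (.inr ε))
  | finally_ok {ρ β s₀ s₁ σ σ₀ η} :
      PosRule M [evS ρ β s₀ σ (.inl σ₀), evS ρ β s₁ σ₀ η] (evS ρ β (.tryFinally s₀ s₁) σ η)
  | finally_exc₀ {ρ β s₀ s₁ σ σ₀ ξ₀ σ₁} :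
      PosRule M [evS ρ β s₀ σ (.inr (σ₀, ξ₀)), evS ρ β s₁ σ₀ (.inl σ₁)]
        (evS ρ β (.tryFinally s₀ s₁) σ (.inr (σ₁, ξ₀)))
  | finally_exc₁ {ρ β s₀ s₁ σ σ₀ ξ₀ ε} :
      PosRule M [evS ρ β s₀ σ (.inr (σ₀, ξ₀)), evS ρ β s₁ σ₀ (.inr ε)]
        (evS ρ β (.tryFinally s₀ s₁) σ (.inr ε))
  | call_param_err {ρ β id₀ id es σ fps' sT₀ fps body ε} :
      FMap.get? β id = some (.fn fps' sT₀) → FMap.get? ρ id = some (.clo fps body) →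
      PosRule M [evD ρ β (callDecl id₀ sT₀ fps es) (markS σ) (.inr ε)]
        (evS ρ β (.call id₀ id es) σ (.inr ε))
  | call_eval_err {ρ β id₀ id es σ fps' sT₀ fps body ρ₀ σ₀ σ₀' β₀ β₁ ε ε' ε''} :
      FMap.get? β id = some (.fn fps' sT₀) → FMap.get? ρ id = some (.clo fps body) →
      EnvTy ρ₀ β₀ → EnvTy (calleeEnv (Loc := Loc) (Ext := Ext) sT₀ fps) β₁ →
      LinkS σ₀ σ₀' → UnlinkE ε ε' → UnmarkE ε' ε'' →
      PosRule M
        [evD ρ β (callDecl id₀ sT₀ fps es) (markS σ) (.inl (ρ₀, σ₀)),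
         evB (ρ.update (calleeEnv sT₀ fps)) (β.update β₁) body σ₀' (.inr ε)]
        (evS ρ β (.call id₀ id es) σ (.inr ε''))
  | call_ok {ρ β id₀ id es σ fps' sT₀ fps body ρ₀ σ₀ σ₀' β₀ β₁ σ₁ σ₁' η₂ η} :
      FMap.get? β id = some (.fn fps' sT₀) → FMap.get? ρ id = some (.clo fps body) →
      EnvTy ρ₀ β₀ → EnvTy (calleeEnv (Loc := Loc) (Ext := Ext) sT₀ fps) β₁ →
      LinkS σ₀ σ₀' → UnlinkS σ₁ σ₁' → UnmarkT η₂ η →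
      PosRule M
        [evD ρ β (callDecl id₀ sT₀ fps es) (markS σ) (.inl (ρ₀, σ₀)),
         evB (ρ.update (calleeEnv sT₀ fps)) (β.update β₁) body σ₀' (.inl σ₁),
         evS (ρ.update ρ₀) (β.update β₀) (.assign id₀ (.var (.rxn 0))) σ₁' η₂]
        (evS ρ β (.call id₀ id es) σ η)
  -- function bodies
  | body_err₀ {ρ β d s e σ ε} :
      PosRule M [evD ρ β d (markS σ) (.inr ε)] (evB ρ β (.letIn d s e) σ (.inr ε))
  | body_err₁ {ρ β d s e σ β₀ ρ₀ σ₀ ε ε'} : DeclTy β d β₀ → UnmarkE ε ε' →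
      PosRule M
        [evD ρ β d (markS σ) (.inl (ρ₀, σ₀)), evS (ρ.update ρ₀) (β.update β₀) s σ₀ (.inr ε)]
        (evB ρ β (.letIn d s e) σ (.inr ε'))
  | body_ok {ρ β d s e σ β₀ ρ₀ σ₀ σ₁ η₀ η} : DeclTy β d β₀ → UnmarkT η₀ η →
      PosRule M
        [evD ρ β d (markS σ) (.inl (ρ₀, σ₀)), evS (ρ.update ρ₀) (β.update β₀) s σ₀ (.inl σ₁),
         evS (ρ.update ρ₀) (β.update β₀) (.assign (.rxn 0) e) σ₁ η₀]
        (evB ρ β (.letIn d s e) σ η)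
  | external_ok {ρ β sT} {σ σ₀ : Mem Loc} : σ₀.2 = σ.2 →
      PosRule M [] (evB ρ β (.external sT) σ (.inl σ₀))
  | external_exc {ρ β sT} {σ σ₀ : Mem Loc} {ξ} : σ₀.2 = σ.2 →
      PosRule M [] (evB ρ β (.external sT) σ (.inr (σ₀, ξ)))
  -- catch clauses
  | catch_caught {ρ β p s σ ξ η₀} : ¬ p.IsVar → p.Matches ξ →
      PosRule M [evS ρ β s σ η₀] (evK ρ β (.clause p s) (σ, ξ) (.inl η₀))
  | catch_var_stk_err {ρ β id sT s σ v ε₀ ε} : v.type = sT →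
      M.NewS (v, markS σ) (.inr ε₀) → UnmarkE ε₀ ε →
      PosRule M [] (evK ρ β (.clause (.var id sT) s) (σ, .val v) (.inl (.inr ε)))
  | catch_var_ok {ρ : Env Loc Ext} {β id sT s σ v σ₀ i η₀ η} : v.type = sT →
      M.NewS (Ext := Ext) (v, markS σ) (.inl (σ₀, i)) → UnmarkT η₀ η →
      PosRule M
        [evS (ρ.update (.single id (.loc (.ind i) sT))) (β.update (.single id (.loc sT))) s σ₀ η₀]
        (evK ρ β (.clause (.var id sT) s) (σ, .val v) (.inl η))
  | catch_uncaught {ρ β p s σ ξ} : ¬ p.Matches ξ →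
      PosRule M [] (evK ρ β (.clause p s) (σ, ξ) (.inr (σ, ξ)))
  | kseq_caught {ρ β k₀ k₁ ε η₀} :
      PosRule M [evK ρ β k₀ ε (.inl η₀)] (evK ρ β (.seq k₀ k₁) ε (.inl η₀))
  | kseq_uncaught {ρ β k₀ k₁ ε ε₀ η} :
      PosRule M [evK ρ β k₀ ε (.inr ε₀), evK ρ β k₁ ε₀ η] (evK ρ β (.seq k₀ k₁) ε η)

/-- The positive concrete semantics rules: the instances of the schemata that consist of
well-formed sequents. -/
def PosR (M : MemImpl Loc) (ps : List (Sequent Loc Ext)) (s : Sequent Loc Ext) : Prop :=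
  PosRule M ps s ∧ (∀ p ∈ ps, p.WF) ∧ s.WF

/-- The concrete evaluation relation. -/
inductive Derivable (M : MemImpl Loc) : Sequent Loc Ext → Prop
  | mk {ps s} : PosR M ps s → (∀ p ∈ ps, Derivable M p) → Derivable M s

/-- The negative concrete semantics rules. -/
inductive NegR (M : MemImpl Loc) : List (Sequent Loc Ext) → Sequent Loc Ext → Prop
  | mk {pre post q₀ ρ₀ β₀ N₀ η₀ q ρ β N η} : q₀.MayDiverge → q.MayDiverge →
      PosR M (pre ++ .pos q₀ ρ₀ β₀ N₀ η₀ :: post) (.pos q ρ β N η) →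
      NegR M (pre ++ [.neg q₀ ρ₀ β₀ N₀]) (.neg q ρ β N)

end ConcreteRules

/-! ## Trees -/

/-- Finitely branching trees of at most `ω` depth with labels in `S`. -/
structure Tree (S : Type u) : Type u where
  label : List ℕ → Option S
  prefix_closed : ∀ z n, (label (z ++ [n])).isSome → (label z).isSome
  canonical : ∀ z, ∃ h, ∀ n, (label (z ++ [n])).isSome ↔ n < h

namespace Tree
variable {S : Type u}

def root (θ : Tree S) : Option S := θ.label []

/-- The subtree `θ_[p]`. -/
def sub (θ : Tree S) (p : List ℕ) : Tree S where
  label z := θ.label (p ++ z)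
  prefix_closed z n := by
    rw [← List.append_assoc]; exact θ.prefix_closed (p ++ z) n
  canonical z := by
    simpa only [List.append_assoc] using θ.canonical (p ++ z)

/-- The tree `θ` has the root `s` and the immediate subtrees `ts`. -/
def Node (θ : Tree S) (ts : List (Tree S)) (s : S) : Prop :=
  θ.root = some s ∧ (∀ i, (θ.label [i]).isSome ↔ i < ts.length) ∧
    ∀ (i : ℕ) (h : i < ts.length), θ.sub [i] = ts[i]

/-- `ps` are the roots of the trees `ts`. -/
def Roots (ts : List (Tree S)) (ps : List S) : Prop :=
  List.Forall₂ (fun t p => t.root = some p) ts ps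

end Tree

section ConcreteTrees
variable {Loc Ext : Type u}

def Fpos (M : MemImpl Loc) : Set (Tree (Sequent Loc Ext)) →o Set (Tree (Sequent Loc Ext)) where
  toFun U := {θ | ∃ ts ps s, θ.Node ts s ∧ Tree.Roots ts ps ∧ PosR M ps s ∧ ∀ t ∈ ts, t ∈ U}
  monotone' := by
    rintro U V h θ ⟨ts, ps, s, h₁, h₂, h₃, h₄⟩
    exact ⟨ts, ps, s, h₁, h₂, h₃, fun t ht => h (h₄ t ht)⟩

/-- Positive concrete semantics trees. -/
def PosTrees (M : MemImpl Loc) : Set (Tree (Sequent Loc Ext)) := (Fpos M).lfp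

def Fneg (M : MemImpl Loc) : Set (Tree (Sequent Loc Ext)) →o Set (Tree (Sequent Loc Ext)) where
  toFun U := {θ | ∃ ts t ps s, θ.Node (ts ++ [t]) s ∧ Tree.Roots (ts ++ [t]) ps ∧ NegR M ps s ∧
    (∀ t' ∈ ts, t' ∈ PosTrees M) ∧ t ∈ U}
  monotone' := by
    rintro U V h θ ⟨ts, t, ps, s, h₁, h₂, h₃, h₄, h₅⟩
    exact ⟨ts, t, ps, s, h₁, h₂, h₃, h₄, h h₅⟩

/-- Negative concrete semantics trees. -/
def NegTrees (M : MemImpl Loc) : Set (Tree (Sequent Loc Ext)) := (Fneg M).gfp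

/-- Concrete semantics trees. -/
def ConcreteTrees (M : MemImpl Loc) : Set (Tree (Sequent Loc Ext)) := PosTrees M ∪ NegTrees M

end ConcreteTrees

/-! ## Abstract domains -/

/-- The smash product. -/
def Smash (A B : Type u) [Bot A] [Bot B] : Type u := {p : A × B // p.1 = ⊥ ↔ p.2 = ⊥}

section Smash
variable {A B : Type u} [SemilatticeSup A] [OrderBot A] [SemilatticeSup B] [OrderBot B]

instance : SemilatticeSup (Smash A B) :=
  Subtype.semilatticeSup fun {x y} hx hy => by
    simp only [Prod.fst_sup, Prod.snd_sup, sup_eq_bot_iff, hx, hy]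

instance : OrderBot (Smash A B) := Subtype.orderBot (by simp)

open Classical in
/-- The constructor of the smash product. -/
noncomputable def spair (a : A) (b : B) : Smash A B :=
  if h : a ≠ ⊥ ∧ b ≠ ⊥ then ⟨(a, b), by simp [h.1, h.2]⟩ else ⊥

end Smash

/-- The carriers of the abstract domains of integers, Booleans, RTS exceptions and memory
structures. -/
structure Carriers : Type (u + 1) where
  IntA : Type u
  BoolA : Type u
  RtsA : Type u
  MemA : Type u
  [intSup : SemilatticeSup IntA]
  [intBounded : BoundedOrder IntA]
  [boolLattice : CompleteLattice BoolA]
  [rtsSup : SemilatticeSup RtsA]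
  [rtsBounded : BoundedOrder RtsA]
  [memSup : SemilatticeSup MemA]
  [memBot : OrderBot MemA]

attribute [instance] Carriers.intSup Carriers.intBounded Carriers.boolLattice Carriers.rtsSup
  Carriers.rtsBounded Carriers.memSup Carriers.memBot

section AbstractStates
variable (A : Carriers.{u})

/-- Abstract storable values. -/
abbrev SValA : Type u := A.IntA × A.BoolA

/-- Abstract exceptions. -/
abbrev ExcA : Type u := A.RtsA × SValA A

/-- Abstract value states. -/
abbrev ValStA : Type u := Smash (SValA A) A.MemA

/-- Abstract exception states. The bottom element is `none♯`. -/
abbrev ExcStA : Type u := Smash A.MemA (ExcA A)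

/-- The state component of abstract non-terminal configurations. -/
@[reducible] def AInSt : Kind → Type u
  | .e | .d | .g | .s | .b => A.MemA
  | .k => ExcStA A

variable (Loc Ext : Type u)

/-- Abstract non-terminal configurations (before typing is taken into account). -/
abbrev ANT (q : Kind) : Type u := Con Loc Ext q × AInSt A q

/-- Abstract terminal configurations. -/
@[reducible] def ATm : Kind → Type u
  | .e => ValStA A × ExcStA A
  | .d | .g => (Env Loc Ext × A.MemA) × ExcStA A
  | .s | .b => A.MemA × ExcStA A
  | .k => (A.MemA × ExcStA A) × ExcStA A

/-- The order on abstract terminal configurations: it is componentwise, and environments are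
only comparable to themselves. -/
def ATm.Le : (q : Kind) → ATm A Loc Ext q → ATm A Loc Ext q → Prop
  | .e, η, η' => η.1 ≤ η'.1 ∧ η.2 ≤ η'.2
  | .d, η, η' => η.1.1 = η'.1.1 ∧ η.1.2 ≤ η'.1.2 ∧ η.2 ≤ η'.2
  | .g, η, η' => η.1.1 = η'.1.1 ∧ η.1.2 ≤ η'.1.2 ∧ η.2 ≤ η'.2
  | .s, η, η' => η.1 ≤ η'.1 ∧ η.2 ≤ η'.2
  | .b, η, η' => η.1 ≤ η'.1 ∧ η.2 ≤ η'.2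
  | .k, η, η' => η.1.1 ≤ η'.1.1 ∧ η.1.2 ≤ η'.1.2 ∧ η.2 ≤ η'.2

/-- The abstract sequent `ρ ⊢_β N♯ → η♯`. -/
inductive ASequent : Type u
  | mk (q : Kind) (ρ : Env Loc Ext) (β : TEnv) (N : ANT A Loc Ext q) (η : ATm A Loc Ext q)

end AbstractStates

/-- The abstract domain `D` approximates `Set C`, through the strict monotonic concretization
function `γ`, with the partial abstraction function `α`. -/
structure Approximation.{v, w} (C : Type v) (D : Type w) [SemilatticeSup D] [OrderBot D] :
    Type (max v w) where
  γ : D → Set C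
  γ_mono : Monotone γ
  γ_bot : γ ⊥ = ∅
  α : Set C → Option D
  α_sound : ∀ c d, α c = some d → c ⊆ γ d
  α_empty : α ∅ = some ⊥

/-- Approximations with a top element, whose abstraction function is defined on singletons. -/
structure TopApproximation.{v, w} (C : Type v) (D : Type w) [SemilatticeSup D]
    [BoundedOrder D] : Type (max v w) extends Approximation C D where
  α_univ : α Set.univ = some ⊤
  α_singleton : ∀ c, (α {c}).isSome

/-- The approximation of Booleans, by a Galois connection with strict `γ`. -/
structure BoolApproximation (D : Type u) [CompleteLattice D] : Type u where
  γ : D → Set Bool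
  α : Set Bool → D
  gc : GaloisConnection α γ
  γ_bot : γ ⊥ = ∅

/-- Abstract domains for the base types, related to the concrete domains. -/
structure AbsDom (Loc Ext : Type u) (A : Carriers.{u}) : Type u where
  int : TopApproximation ℤ A.IntA
  bool : BoolApproximation A.BoolA
  rts : TopApproximation (RTSExcept Ext) A.RtsA
  mem : Approximation (Mem Loc) A.MemA

section ApproximationRelations
variable {Loc Ext : Type u} {A : Carriers.{u}} (D : AbsDom Loc Ext A)

def SValApprox : SVal → SValA A → Prop
  | .int m, v => m ∈ D.int.γ v.1
  | .bool t, v => t ∈ D.bool.γ v.2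

def ExcApprox : Exc Ext → ExcA A → Prop
  | .rts χ, ξ => χ ∈ D.rts.γ ξ.1
  | .val v, ξ => SValApprox D v ξ.2

def ValStApprox (υ : ValState Loc) (υA : ValStA A) : Prop :=
  SValApprox D υ.1 υA.1.1 ∧ υ.2 ∈ D.mem.γ υA.1.2

def ExcStApprox (ε : ExcState Loc Ext) (εA : ExcStA A) : Prop :=
  ε.1 ∈ D.mem.γ εA.1.1 ∧ ExcApprox D ε.2 εA.1.2

def InStApprox : (q : Kind) → InSt Loc Ext q → AInSt A q → Prop
  | .e, σ, σA => σ ∈ D.mem.γ σA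
  | .d, σ, σA => σ ∈ D.mem.γ σA
  | .g, σ, σA => σ ∈ D.mem.γ σA
  | .s, σ, σA => σ ∈ D.mem.γ σA
  | .b, σ, σA => σ ∈ D.mem.γ σA
  | .k, ε, εA => ExcStApprox D ε εA

/-- `N ∝ N♯`. -/
def NTApprox {q : Kind} (N : NT Loc Ext q) (NA : ANT A Loc Ext q) : Prop :=
  N.1 = NA.1 ∧ InStApprox D q N.2 NA.2

def MemApprox : Mem Loc ⊕ ExcState Loc Ext → A.MemA × ExcStA A → Prop
  | .inl σ, ηA => σ ∈ D.mem.γ ηA.1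
  | .inr ε, ηA => ExcStApprox D ε ηA.2

def ValApprox : ValState Loc ⊕ ExcState Loc Ext → ValStA A × ExcStA A → Prop
  | .inl υ, ηA => ValStApprox D υ ηA.1
  | .inr ε, ηA => ExcStApprox D ε ηA.2

def EnvApprox : (Env Loc Ext × Mem Loc) ⊕ ExcState Loc Ext →
    (Env Loc Ext × A.MemA) × ExcStA A → Prop
  | .inl r, ηA => r.1 = ηA.1.1 ∧ r.2 ∈ D.mem.γ ηA.1.2
  | .inr ε, ηA => ExcStApprox D ε ηA.2

def CatchApprox : (Mem Loc ⊕ ExcState Loc Ext) ⊕ ExcState Loc Ext →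
    (A.MemA × ExcStA A) × ExcStA A → Prop
  | .inl η, ηA => MemApprox D η ηA.1
  | .inr ε, ηA => ExcStApprox D ε ηA.2

/-- `η ∝ η♯`. -/
def TmApprox : {q : Kind} → Tm Loc Ext q → ATm A Loc Ext q → Prop
  | .e, η, ηA => ValApprox D η ηA
  | .d, η, ηA => EnvApprox D η ηA
  | .g, η, ηA => EnvApprox D η ηA
  | .s, η, ηA => MemApprox D η ηA
  | .b, η, ηA => MemApprox D η ηA
  | .k, η, ηA => CatchApprox D η ηA

/-- The approximation relation between concrete and abstract sequents. -/
inductive SeqApprox : Sequent Loc Ext → ASequent A Loc Ext → Prop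
  | pos {q ρ β N η NA ηA} : NTApprox D N NA → TmApprox D η ηA →
      SeqApprox (.pos q ρ β N η) (.mk q ρ β NA ηA)
  | neg {q ρ β N NA ηA} : NTApprox D N NA → SeqApprox (.neg q ρ β N) (.mk q ρ β NA ηA)

/-- The abstraction of the singleton that contains the given constant. -/
def AbsDom.alphaCon : SVal → Option (SValA A)
  | .int m => (D.int.α {m}).map fun m' => (m', ⊥)
  | .bool t => some (⊥, D.bool.α {t})

/-- The abstraction of the singleton that contains the given RTS exception. -/
def AbsDom.alphaRts (χ : RTSExcept Ext) : Option (ExcA A) :=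
  (D.rts.α {χ}).map fun χ' => (χ', ⊥)

end ApproximationRelations

/-! ## The parameters of the abstract semantics -/

/-- The abstract domains with their sound abstract operators, filters and evaluation function. -/
structure AbsSem {Loc : Type u} (Ext : Type u) (M : MemImpl Loc) (A : Carriers.{u}) : Type u
    extends AbsDom Loc Ext A where
  negA : A.IntA → A.IntA
  negA_sound : ∀ mA, ∀ m ∈ int.γ mA, -m ∈ int.γ (negA mA)
  arithA : ArithOp → A.IntA → A.IntA → A.IntA
  arithA_sound : ∀ op m₀A m₁A, ∀ m₀ ∈ int.γ m₀A, ∀ m₁ ∈ int.γ m₁A,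
    (¬ op.IsDiv ∨ m₁ ≠ 0) → op.eval m₀ m₁ ∈ int.γ (arithA op m₀A m₁A)
  testA : TestOp → A.IntA → A.IntA → A.BoolA
  testA_sound : ∀ op m₀A m₁A, ∀ m₀ ∈ int.γ m₀A, ∀ m₁ ∈ int.γ m₁A,
    op.eval m₀ m₁ ∈ bool.γ (testA op m₀A m₁A)
  notA : A.BoolA → A.BoolA
  notA_sound : ∀ tA, ∀ t ∈ bool.γ tA, (!t) ∈ bool.γ (notA tA)
  readA : A.MemA → Addr Loc → SType → ValStA A × ExcStA A
  readA_sound : ∀ σA a sT, ∀ σ ∈ mem.γ σA, ValApprox toAbsDom (Mem.read σ a sT) (readA σA a sT)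
  writeA : A.MemA → Addr Loc → SType → SValA A → A.MemA × ExcStA A
  writeA_sound : ∀ σA a sT vA, ∀ σ ∈ mem.γ σA, ∀ v, SValApprox toAbsDom v vA →
    ∀ η, M.Write σ a sT v η → MemApprox toAbsDom η (writeA σA a sT vA)
  /-- Since the abstract result carries the concrete address, allocation is only required to be
  defined where this address is determined. -/
  newDA : ValStA A → Option ((A.MemA × Loc) × ExcStA A)
  newDA_sound : ∀ υA σA a' εA, newDA υA = some ((σA, a'), εA) →
    ∀ υ, ValStApprox toAbsDom υ υA →
      (∀ σ a, M.NewD (Ext := Ext) υ (.inl (σ, a)) → σ ∈ mem.γ σA ∧ a = a') ∧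
      (∀ ε, M.NewD υ (.inr ε) → ExcStApprox toAbsDom ε εA)
  newSA : ValStA A → Option ((A.MemA × ℕ) × ExcStA A)
  newSA_sound : ∀ υA σA a' εA, newSA υA = some ((σA, a'), εA) →
    ∀ υ, ValStApprox toAbsDom υ υA →
      (∀ σ a, M.NewS (Ext := Ext) υ (.inl (σ, a)) → σ ∈ mem.γ σA ∧ a = a') ∧
      (∀ ε, M.NewS υ (.inr ε) → ExcStApprox toAbsDom ε εA)
  cleanupDA : ExcStA A → ExcStA A
  cleanupDA_sound : ∀ εA ε, ExcStApprox toAbsDom ε εA →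
    ExcStApprox toAbsDom (cleanupD ε) (cleanupDA εA)
  markA : A.MemA → A.MemA
  markA_sound : ∀ σA, ∀ σ ∈ mem.γ σA, markS σ ∈ mem.γ (markA σA)
  unmarkA : A.MemA → A.MemA
  unmarkA_sound : ∀ σA, ∀ σ ∈ mem.γ σA, ∀ σ', UnmarkS σ σ' → σ' ∈ mem.γ (unmarkA σA)
  linkA : A.MemA → A.MemA
  linkA_sound : ∀ σA, ∀ σ ∈ mem.γ σA, ∀ σ', LinkS σ σ' → σ' ∈ mem.γ (linkA σA)
  unlinkA : A.MemA → A.MemA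
  unlinkA_sound : ∀ σA, ∀ σ ∈ mem.γ σA, ∀ σ', UnlinkS σ σ' → σ' ∈ mem.γ (unlinkA σA)
  /-- The memory structure filter. -/
  φ : Env Loc Ext → A.MemA → Exp → A.MemA
  φ_sound : ∀ e β ρ σA, ExpTy β e .boolean → Compat ρ β → ∀ σ ∈ mem.γ σA, ∀ σtt,
    Derivable M (evE ρ β e σ (.inl (.bool true, σtt))) → σtt ∈ mem.γ (φ ρ σA e)
  /-- The exception state filters. -/
  φpos : ExcDecl Ext → ExcStA A → ExcStA A
  φpos_sound : ∀ p εA ε, ExcStApprox toAbsDom ε εA → p.Matches ε.2 →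
    ExcStApprox toAbsDom ε (φpos p εA)
  φneg : ExcDecl Ext → ExcStA A → ExcStA A
  φneg_sound : ∀ p εA ε, ExcStApprox toAbsDom ε εA → ¬ p.Matches ε.2 →
    ExcStApprox toAbsDom ε (φneg p εA)
  /-- The directly supported configurations, and their abstract evaluation. -/
  supported : Env Loc Ext → (q : Kind) → ANT A Loc Ext q → Prop
  supported_kind : ∀ ρ q NA, supported ρ q NA → q ≠ .b ∧ q ≠ .k
  eval : Env Loc Ext → (q : Kind) → ANT A Loc Ext q → Option (ATm A Loc Ext q)
  eval_sound : ∀ ρ β q NA, Compat ρ β → WellTyped β q NA.1 → supported ρ q NA →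
    ∃ ηA, eval ρ q NA = some ηA ∧ ∀ N η, NTApprox toAbsDom N NA →
      Derivable M (.pos q ρ β N η) → TmApprox toAbsDom η ηA

section AbstractRules
variable {Loc Ext : Type u} {M : MemImpl Loc} {A : Carriers.{u}} (D : AbsSem Ext M A)

/-- The lifting of `unmark♯` to abstract exception states. -/
noncomputable def AbsSem.unmarkEA (εA : ExcStA A) : ExcStA A := spair (D.unmarkA εA.1.1) εA.1.2

/-- The lifting of `unlink♯` to abstract exception states. -/
noncomputable def AbsSem.unlinkEA (εA : ExcStA A) : ExcStA A := spair (D.unlinkA εA.1.1) εA.1.2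

/-- The selectors `sT(ε♯)`, as abstract storable values. -/
def selA : SType → ExcStA A → SValA A
  | .integer, εA => (εA.1.2.2.1, ⊥)
  | .boolean, εA => (⊥, εA.1.2.2.2)

abbrev avE (ρ : Env Loc Ext) (β : TEnv) (e : Exp) (σ : A.MemA) (η : ValStA A × ExcStA A) :
    ASequent A Loc Ext := .mk .e ρ β (⟨e⟩, σ) η

abbrev avD (ρ : Env Loc Ext) (β : TEnv) (d : Decl Loc Ext) (σ : A.MemA)
    (η : (Env Loc Ext × A.MemA) × ExcStA A) : ASequent A Loc Ext := .mk .d ρ β (d, σ) η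

abbrev avG (ρ : Env Loc Ext) (β : TEnv) (g : Glob Loc Ext) (σ : A.MemA)
    (η : (Env Loc Ext × A.MemA) × ExcStA A) : ASequent A Loc Ext := .mk .g ρ β (g, σ) η

abbrev avS (ρ : Env Loc Ext) (β : TEnv) (s : Stmt Loc Ext) (σ : A.MemA)
    (η : A.MemA × ExcStA A) : ASequent A Loc Ext := .mk .s ρ β (s, σ) η

abbrev avB (ρ : Env Loc Ext) (β : TEnv) (b : Body Loc Ext) (σ : A.MemA)
    (η : A.MemA × ExcStA A) : ASequent A Loc Ext := .mk .b ρ β (b, σ) η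

abbrev avK (ρ : Env Loc Ext) (β : TEnv) (k : Catch Loc Ext) (ε : ExcStA A)
    (η : (A.MemA × ExcStA A) × ExcStA A) : ASequent A Loc Ext := .mk .k ρ β (k, ε) η

/-- The abstract rule schemata, before weakening. A premise on an abstract value state `υ`
whose value has to be an abstract integer (resp. Boolean) requires that its Boolean (resp.
integer) component be `⊥`. -/
inductive AbsSchema : List (ASequent A Loc Ext) → ASequent A Loc Ext → Prop
  -- expressions
  | con {ρ β c σ v} : D.alphaCon c = some v →
      AbsSchema [] (avE ρ β (.con c) σ (spair v σ, ⊥))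
  | var {ρ β id σ a sT} : FMap.get? ρ id = some (.loc a sT) →
      AbsSchema [] (avE ρ β (.var id) σ (D.readA σ a sT))
  | neg {ρ β e σ ε} {υ : ValStA A} : υ.1.1.2 = ⊥ →
      AbsSchema [avE ρ β e σ (υ, ε)]
        (avE ρ β (.neg e) σ (spair (D.negA υ.1.1.1, ⊥) υ.1.2, ε))
  | arith {ρ β op e₀ e₁ σ ε₀ ε₁} {υ₀ υ₁ : ValStA A} : υ₀.1.1.2 = ⊥ → υ₁.1.1.2 = ⊥ →
      (¬ op.IsDiv ∨ (0 : ℤ) ∉ D.int.γ υ₁.1.1.1) →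
      AbsSchema [avE ρ β e₀ σ (υ₀, ε₀), avE ρ β e₁ υ₀.1.2 (υ₁, ε₁)]
        (avE ρ β (.arith op e₀ e₁) σ
          (spair (D.arithA op υ₀.1.1.1 υ₁.1.1.1, ⊥) υ₁.1.2, ε₀ ⊔ ε₁))
  | arith_exc {ρ β op e₀ e₁ σ ε₀ ε₁ ξ} {υ₀ υ₁ : ValStA A} : υ₀.1.1.2 = ⊥ → υ₁.1.1.2 = ⊥ →
      op.IsDiv → (0 : ℤ) ∈ D.int.γ υ₁.1.1.1 → D.alphaRts .divbyzero = some ξ →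
      AbsSchema [avE ρ β e₀ σ (υ₀, ε₀), avE ρ β e₁ υ₀.1.2 (υ₁, ε₁)]
        (avE ρ β (.arith op e₀ e₁) σ
          (spair (D.arithA op υ₀.1.1.1 υ₁.1.1.1, ⊥) υ₁.1.2, ε₀ ⊔ ε₁ ⊔ spair υ₁.1.2 ξ))
  | test {ρ β op e₀ e₁ σ ε₀ ε₁} {υ₀ υ₁ : ValStA A} : υ₀.1.1.2 = ⊥ → υ₁.1.1.2 = ⊥ →
      AbsSchema [avE ρ β e₀ σ (υ₀, ε₀), avE ρ β e₁ υ₀.1.2 (υ₁, ε₁)]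
        (avE ρ β (.test op e₀ e₁) σ
          (spair (⊥, D.testA op υ₀.1.1.1 υ₁.1.1.1) υ₁.1.2, ε₀ ⊔ ε₁))
  | not {ρ β e σ ε} {υ : ValStA A} : υ.1.1.1 = ⊥ →
      AbsSchema [avE ρ β e σ (υ, ε)]
        (avE ρ β (.not e) σ (spair (⊥, D.notA υ.1.1.2) υ.1.2, ε))
  | and {ρ β e₀ e₁ σ υ₀ ε₀ υ₁ ε₁ v} : D.alphaCon (.bool false) = some v →
      AbsSchema [avE ρ β e₀ σ (υ₀, ε₀), avE ρ β e₁ (D.φ ρ σ e₀) (υ₁, ε₁)]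
        (avE ρ β (.and e₀ e₁) σ (spair v (D.φ ρ σ (.not e₀)) ⊔ υ₁, ε₀ ⊔ ε₁))
  | or {ρ β e₀ e₁ σ υ₀ ε₀ υ₁ ε₁ v} : D.alphaCon (.bool true) = some v →
      AbsSchema [avE ρ β e₀ σ (υ₀, ε₀), avE ρ β e₁ (D.φ ρ σ (.not e₀)) (υ₁, ε₁)]
        (avE ρ β (.or e₀ e₁) σ (spair v (D.φ ρ σ e₀) ⊔ υ₁, ε₀ ⊔ ε₁))
  -- declarations
  | nil {ρ β σ} : AbsSchema [] (avD ρ β .nil σ ((.empty, σ), ⊥))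
  | env {ρ β σ} {ρ₀ : Env Loc Ext} :
      AbsSchema [] (avD ρ β (Env.toDecl ρ₀) σ ((ρ₀, σ), ⊥))
  | recEnv {ρ β σ} {ρ₀ : Env Loc Ext} :
      AbsSchema [] (avD ρ β (Env.toRecDecl ρ₀) σ ((unfoldRec ρ₀, σ), ⊥))
  | gvar {ρ β id sT e σ υ ε₀ σ₁ l ε₁} : D.newDA υ = some ((σ₁, l), ε₁) →
      AbsSchema [avE ρ β e σ (υ, ε₀)]
        (avG ρ β (.gvar id sT e) σ
          ((.single id (.loc (.loc l) sT), σ₁), D.cleanupDA (ε₀ ⊔ ε₁)))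
  | lvar {ρ β id sT e σ υ ε₀ σ₁ i ε₁} : D.newSA υ = some ((σ₁, i), ε₁) →
      AbsSchema [avE ρ β e σ (υ, ε₀)]
        (avD ρ β (.lvar id sT e) σ
          ((.single id (.loc (.ind i) sT), σ₁), D.unmarkEA (ε₀ ⊔ ε₁)))
  | function {ρ β id fps body σ} :
      AbsSchema []
        (avG ρ β (.function id fps body) σ
          ((.single id (.clo fps (closeBody ρ fps body)), σ), ⊥))
  | recG {ρ : Env Loc Ext} {β g σ β₀ ρ₀ σ₀ η} : GlobTy β (.recG g) β₀ →
      AbsSchema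
        [avG (ρ.without (g.FI ∩ g.DI)) (β.update (β₀.restrict (g.FI ∩ g.DI))) g σ
          ((ρ₀, σ₀), ⊥),
         avD ρ β (Env.toRecDecl ρ₀) σ₀ η]
        (avG ρ β (.recG g) σ η)
  | gseq {ρ β g₀ g₁ σ β₀ ρ₀ σ₀ ε₀ ρ₁ σ₁ ε₁} : GlobTy β g₀ β₀ →
      AbsSchema
        [avG ρ β g₀ σ ((ρ₀, σ₀), ε₀), avG (ρ.update ρ₀) (β.update β₀) g₁ σ₀ ((ρ₁, σ₁), ε₁)]
        (avG ρ β (.seq g₀ g₁) σ ((ρ₀.update ρ₁, σ₁), ε₀ ⊔ ε₁))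
  | dseq {ρ β d₀ d₁ σ β₀ ρ₀ σ₀ ε₀ ρ₁ σ₁ ε₁} : DeclTy β d₀ β₀ →
      AbsSchema
        [avD ρ β d₀ σ ((ρ₀, σ₀), ε₀), avD (ρ.update ρ₀) (β.update β₀) d₁ σ₀ ((ρ₁, σ₁), ε₁)]
        (avD ρ β (.seq d₀ d₁) σ ((ρ₀.update ρ₁, σ₁), ε₀ ⊔ ε₁))
  -- statements
  | nop {ρ β σ} : AbsSchema [] (avS ρ β .nop σ (σ, ⊥))
  | assign {ρ β id e σ ε₀ a sT} {υ : ValStA A} : FMap.get? ρ id = some (.loc a sT) →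
      AbsSchema [avE ρ β e σ (υ, ε₀)]
        (avS ρ β (.assign id e) σ
          ((D.writeA υ.1.2 a sT υ.1.1).1, ε₀ ⊔ (D.writeA υ.1.2 a sT υ.1.1).2))
  | sseq {ρ β s₀ s₁ σ σ₀ ε₀ σ₁ ε₁} :
      AbsSchema [avS ρ β s₀ σ (σ₀, ε₀), avS ρ β s₁ σ₀ (σ₁, ε₁)]
        (avS ρ β (.seq s₀ s₁) σ (σ₁, ε₀ ⊔ ε₁))
  | block {ρ β d s σ β₀ ρ₀ σ₀ ε₀ σ₁ ε₁} : DeclTy β d β₀ →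
      AbsSchema
        [avD ρ β d (D.markA σ) ((ρ₀, σ₀), ε₀),
         avS (ρ.update ρ₀) (β.update β₀) s σ₀ (σ₁, ε₁)]
        (avS ρ β (.block d s) σ (D.unmarkA σ₁, ε₀ ⊔ D.unmarkEA ε₁))
  | ite {ρ β e s₀ s₁ σ υ₀ ε₀ σ₁ ε₁ σ₂ ε₂} :
      AbsSchema
        [avE ρ β e σ (υ₀, ε₀), avS ρ β s₀ (D.φ ρ σ e) (σ₁, ε₁),
         avS ρ β s₁ (D.φ ρ σ (.not e)) (σ₂, ε₂)]
        (avS ρ β (.ite e s₀ s₁) σ (σ₁ ⊔ σ₂, ε₀ ⊔ ε₁ ⊔ ε₂))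
  | whileDo {ρ β e s σ υ₀ ε₀ σ₁ ε₁ σ₂ ε₂} :
      AbsSchema
        [avE ρ β e σ (υ₀, ε₀), avS ρ β s (D.φ ρ σ e) (σ₁, ε₁),
         avS ρ β (.whileDo e s) σ₁ (σ₂, ε₂)]
        (avS ρ β (.whileDo e s) σ (D.φ ρ σ (.not e) ⊔ σ₂, ε₀ ⊔ ε₁ ⊔ ε₂))
  | throwRts {ρ β χ σ ξ} : D.alphaRts χ = some ξ →
      AbsSchema [] (avS ρ β (.throwRts χ) σ (⊥, spair σ ξ))
  | throwExp {ρ β e σ ε₀} {υ : ValStA A} :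
      AbsSchema [avE ρ β e σ (υ, ε₀)]
        (avS ρ β (.throwExp e) σ (⊥, ε₀ ⊔ spair υ.1.2 (⊥, υ.1.1)))
  | tryCatch {ρ β s k σ σ₀ ε₀ σ₁ ε₁ ε₂} :
      AbsSchema [avS ρ β s σ (σ₀, ε₀), avK ρ β k ε₀ ((σ₁, ε₁), ε₂)]
        (avS ρ β (.tryCatch s k) σ (σ₀ ⊔ σ₁, ε₁ ⊔ ε₂))
  | tryFinally {ρ β s₀ s₁ σ σ₀ σ₂ ε₂ σ₃ ε₃} {ε₁ : ExcStA A} :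
      AbsSchema
        [avS ρ β s₀ σ (σ₀, ε₁), avS ρ β s₁ σ₀ (σ₂, ε₂), avS ρ β s₁ ε₁.1.1 (σ₃, ε₃)]
        (avS ρ β (.tryFinally s₀ s₁) σ (σ₂, ε₂ ⊔ ε₃ ⊔ spair σ₃ ε₁.1.2))
  | call {ρ β id₀ id es σ fps' sT₀ fps body ρ₀ σ₀ ε₀ β₀ β₁ σ₁ ε₁ σ₂ ε₂} :
      FMap.get? β id = some (.fn fps' sT₀) → FMap.get? ρ id = some (.clo fps body) →
      EnvTy ρ₀ β₀ → EnvTy (calleeEnv (Loc := Loc) (Ext := Ext) sT₀ fps) β₁ →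
      AbsSchema
        [avD ρ β (callDecl id₀ sT₀ fps es) (D.markA σ) ((ρ₀, σ₀), ε₀),
         avB (ρ.update (calleeEnv sT₀ fps)) (β.update β₁) body (D.linkA σ₀) (σ₁, ε₁),
         avS (ρ.update ρ₀) (β.update β₀) (.assign id₀ (.var (.rxn 0))) (D.unlinkA σ₁) (σ₂, ε₂)]
        (avS ρ β (.call id₀ id es) σ
          (D.unmarkA σ₂, ε₀ ⊔ D.unmarkEA (D.unlinkEA ε₁) ⊔ D.unmarkEA ε₂))
  -- function bodies
  | letIn {ρ β d s e σ β₀ ρ₀ σ₀ ε₀ σ₁ ε₁ σ₂ ε₂} : DeclTy β d β₀ →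
      AbsSchema
        [avD ρ β d (D.markA σ) ((ρ₀, σ₀), ε₀),
         avS (ρ.update ρ₀) (β.update β₀) s σ₀ (σ₁, ε₁),
         avS (ρ.update ρ₀) (β.update β₀) (.assign (.rxn 0) e) σ₁ (σ₂, ε₂)]
        (avB ρ β (.letIn d s e) σ (D.unmarkA σ₂, ε₀ ⊔ D.unmarkEA (ε₁ ⊔ ε₂)))
  | external {ρ β sT σ} {σ₀ : A.MemA} :
      (∀ σ' σ₀' : Mem Loc, σ₀'.2 = σ'.2 → σ' ∈ D.mem.γ σ → σ₀' ∈ D.mem.γ σ₀) →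
      AbsSchema [] (avB ρ β (.external sT) σ (σ₀, spair σ₀ ⊤))
  -- catch clauses
  | clause {ρ β p s ε η₁} : ¬ p.IsVar →
      AbsSchema [avS ρ β s (D.φpos p ε).1.1 η₁]
        (avK ρ β (.clause p s) ε (η₁, D.φneg p ε))
  | clause_var {ρ : Env Loc Ext} {β id sT s ε σ₂ i ε₂ σ₃ ε₃} :
      D.newSA (spair (selA sT (D.φpos (.ty (.st sT)) ε))
        (D.markA (D.φpos (.ty (.st sT)) ε).1.1)) = some ((σ₂, i), ε₂) →
      AbsSchema
        [avS (ρ.update (.single id (.loc (.ind i) sT))) (β.update (.single id (.loc sT))) s σ₂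
          (σ₃, ε₃)]
        (avK ρ β (.clause (.var id sT) s) ε
          ((D.unmarkA σ₃, D.unmarkEA ε₂ ⊔ D.unmarkEA ε₃), D.φneg (.ty (.st sT)) ε))
  | kseq {ρ β k₀ k₁ ε σ₀ ε₀ ε₁ σ₁ ε₂ ε₃} :
      AbsSchema [avK ρ β k₀ ε ((σ₀, ε₀), ε₁), avK ρ β k₁ ε₁ ((σ₁, ε₂), ε₃)]
        (avK ρ β (.seq k₀ k₁) ε ((σ₀ ⊔ σ₁, ε₀ ⊔ ε₂), ε₃))

/-- The conditions that all abstract sequents have to satisfy. -/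
def ASequent.WF : ASequent A Loc Ext → Prop
  | .mk q ρ β N _ => Compat ρ β ∧ WellTyped β q N.1

/-- The abstract semantics rules: the conclusion of a schema instance may be weakened and, for
supported configurations, its result is given by the abstract evaluation function. -/
inductive AbsR : List (ASequent A Loc Ext) → ASequent A Loc Ext → Prop
  | unsupported {ps q ρ β N η₀ η} : AbsSchema D ps (.mk q ρ β N η₀) →
      ¬ D.supported ρ q N → ATm.Le A Loc Ext q η₀ η →
      (∀ p ∈ ps, p.WF) → (ASequent.mk q ρ β N η).WF → AbsR ps (.mk q ρ β N η)
  | supported {ps q ρ β N η₀ η₁ η} : AbsSchema D ps (.mk q ρ β N η₀) →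
      D.supported ρ q N → D.eval ρ q N = some η₁ → ATm.Le A Loc Ext q η₁ η →
      (∀ p ∈ ps, p.WF) → (ASequent.mk q ρ β N η).WF → AbsR ps (.mk q ρ β N η)

def Fabs : Set (Tree (ASequent A Loc Ext)) →o Set (Tree (ASequent A Loc Ext)) where
  toFun U := {θ | ∃ ts ps s, θ.Node ts s ∧ Tree.Roots ts ps ∧ AbsR D ps s ∧ ∀ t ∈ ts, t ∈ U}
  monotone' := by
    rintro U V h θ ⟨ts, ps, s, h₁, h₂, h₃, h₄⟩
    exact ⟨ts, ps, s, h₁, h₂, h₃, fun t ht => h (h₄ t ht)⟩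

/-- Abstract semantics trees. -/
def AbstractTrees : Set (Tree (ASequent A Loc Ext)) := (Fabs D).gfp

/-- The operator whose greatest fixpoint is the approximation relation on trees: the roots
approximate each other, and every immediate subtree of the concrete tree is related to some
immediate subtree of the abstract tree. -/
def Fapprox : Set (Tree (Sequent Loc Ext) × Tree (ASequent A Loc Ext)) →o
    Set (Tree (Sequent Loc Ext) × Tree (ASequent A Loc Ext)) where
  toFun U := {x | x.1 ∈ ConcreteTrees M ∧ x.2 ∈ AbstractTrees D ∧
    (∃ s sA, x.1.root = some s ∧ x.2.root = some sA ∧ SeqApprox D.toAbsDom s sA) ∧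
    ∀ i, (x.1.label [i]).isSome →
      ∃ j, (x.2.label [j]).isSome ∧ (x.1.sub [i], x.2.sub [j]) ∈ U}
  monotone' := by
    rintro U V h x ⟨h₁, h₂, h₃, h₄⟩
    refine ⟨h₁, h₂, h₃, fun i hi => ?_⟩
    obtain ⟨j, hj, hU⟩ := h₄ i hi
    exact ⟨j, hj, h hU⟩

/-- `θ ∝ θ♯` on trees. -/
def TreeApprox (θ : Tree (Sequent Loc Ext)) (θA : Tree (ASequent A Loc Ext)) : Prop :=
  (θ, θA) ∈ (Fapprox D).gfp

end AbstractRules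

end CPM

-- The relation on trees is a greatest fixpoint, so the theorem is proved by coinduction. The
-- candidate relation consists of the pairs of a concrete and an abstract tree whose roots have the
-- same environments and corresponding non-terminal configurations (`RootCorr`). It says nothing
-- about results, so it is exactly what the hypotheses provide. It must be shown to be a
-- post-fixpoint: the roots of related trees approximate each other, and each immediate subtree on
-- the concrete side is related to one on the abstract side.
--
-- Both facts rest on a one-step simulation of rules (`PosRule.sim`). Take a concrete rule instance
-- and an abstract schema instance with corresponding conclusions. Read the concrete premises from
-- left to right. Each of them corresponds to some abstract premise, provided that the earlier ones
-- are derivable and approximated, and when all are, the concrete result is described by the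
-- abstract one. The predicate `Sim` packages this dependency. Derivability belongs to it because
-- the guard filter is sound with respect to derivable evaluations only.
--
-- For positive trees, approximation at the root follows by induction on the concrete tree
-- (`posTrees_rootSound`): the abstract tree may be infinite, but one unfolding per induction step
-- suffices. For divergent sequents there is no result to approximate. The premises of a negative
-- rule form an initial segment of those of a positive rule, with the last result forgotten, and
-- correspondence never looks at results, so the same simulation yields the abstract partner of the
-- divergent subtree. Directly supported configurations keep the premises of their schema, so
-- subtrees are matched as before, while the result is justified by the soundness of `eval`.
--
-- Matching premises requires equal type environments in the sequents, although the concrete and the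
-- abstract rule choose theirs independently. This is why types of declarations and environments
-- must be unique. Recursion makes that delicate, since the type being determined also occurs among
-- the assumptions. The way out is that the return type of a function is the type of its result
-- expression, and expressions contain no calls: only the types of variables matter.

namespace CPM

-- Uniqueness of the types of declarations and environments.

section TypingUniqueness
variable {Loc Ext : Type u}

/-- Two type environments that agree on the types of variables. -/
def LocAgree (β β' : TEnv) : Prop :=
  ∀ x sT, β.get? x = some (.loc sT) ↔ β'.get? x = some (.loc sT)

theorem LocAgree.refl (β : TEnv) : LocAgree β β := fun _ _ => Iff.rfl

theorem LocAgree.update {β β' : TEnv} (h : LocAgree β β') (δ : TEnv) :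
    LocAgree (β.update δ) (β'.update δ) := by
  intro x sT
  rw [FMap.get?_update, FMap.get?_update]
  split_ifs
  · rfl
  · exact h x sT

theorem FMap.get?_isSome {V : Type u} (f : FMap V) (x : Ident) :
    (f.get? x).isSome ↔ x ∈ f.dom := by
  unfold FMap.get?
  split_ifs with h <;> simp [h]

theorem FMap.get?_eq_none {V : Type u} {f : FMap V} {x : Ident} (h : x ∉ f.dom) :
    f.get? x = none := by
  simp [FMap.get?, h]

theorem FMap.get?_eq_some {V : Type u} {f : FMap V} {x : Ident} (h : x ∈ f.dom) :
    f.get? x = some (f.val ⟨x, h⟩) := by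
  simp [FMap.get?, h]

/-- Only the rule for identifiers consults the type environment, and it consults location types
only. This is the base on which all insensitivity to function types rests. -/
theorem ExpTy.unique {β β' : TEnv} (hβ : LocAgree β β') {e : Exp} {sT sT' : SType}
    (h : ExpTy β e sT) (h' : ExpTy β' e sT') : sT = sT' := by
  cases h <;> cases h' <;> try rfl
  next h₁ h₂ =>
    rw [hβ, h₂] at h₁
    cases h₁; rfl

theorem FpsTy.unique {fps : FormParams} {δ δ' : TEnv} (h : FpsTy fps δ) (h' : FpsTy fps δ') :
    δ = δ' := by
  induction h generalizing δ' with
  | nil => cases h'; rfl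
  | cons _ _ ih => cases h' with | cons h₁ _ => rw [ih h₁]

/-- A typed address carries its own location type, and a closure never has one. So the variables of
an environment are typed alike in any two candidates, before anything is known about the types of
its closures. -/
theorem EnvTy.locAgree {ρ : Env Loc Ext} {δ δ' : TEnv} (h : EnvTy ρ δ) (h' : EnvTy ρ δ') :
    LocAgree δ δ' := by
  have key : ∀ {δ δ' : TEnv}, EnvTy ρ δ → EnvTy ρ δ' → ∀ x sT,
      δ.get? x = some (.loc sT) → δ'.get? x = some (.loc sT) := by
    rintro δ δ' ⟨hd, hv⟩ ⟨hd', hv'⟩ x sT hx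
    have hm : x ∈ δ.dom := (FMap.get?_isSome _ _).1 (by rw [hx]; rfl)
    have hρ := FMap.get?_eq_some (hd ▸ hm : x ∈ ρ.dom)
    have hδ' := FMap.get?_eq_some (hd' ▸ hd ▸ hm : x ∈ δ'.dom)
    have t := hv _ _ _ hρ hx
    have t' := hv' _ _ _ hρ hδ'
    rw [hδ']
    -- By `t` the value is an address of type `sT`, which then leaves only one choice for the type
    -- in `t'`.
    generalize ρ.val _ = v at t t'
    generalize δ'.val _ = τ at t'
    cases t; cases t'; rfl
  exact fun x sT => ⟨key h h' x sT, key h' h x sT⟩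

/-- `EnvTy` checks each closure in the very type environment being assigned, so two candidates check
it under different assumptions. They agree on variables, and uniqueness for the individual values up
to such agreement, taken as the hypothesis `hu`, then identifies them. Abstracting `hu` lets the
mutual recursion below supply its own recursive calls. -/
theorem EnvTy.unique_of_dval {I : Finset Ident} {ρ : {x // x ∈ I} → DVal Loc Ext} {δ δ' : TEnv}
    (h : EnvTy ⟨I, ρ⟩ δ)
    (hu : ∀ x, ∀ {β β' : TEnv} {τ τ' : DType}, LocAgree β β' → DValTy β (ρ x) τ →
      DValTy β' (ρ x) τ' → τ = τ')
    (h' : EnvTy ⟨I, ρ⟩ δ') : δ = δ' := by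
  have hag := h.locAgree h'
  obtain ⟨hd, hv⟩ := h
  obtain ⟨hd', hv'⟩ := h'
  refine FMap.get?_inj fun x => ?_
  by_cases hx : x ∈ I
  · have hδ := FMap.get?_eq_some (hd ▸ hx : x ∈ δ.dom)
    have hδ' := FMap.get?_eq_some (hd' ▸ hx : x ∈ δ'.dom)
    have hρ := FMap.get?_eq_some (f := ⟨I, ρ⟩) hx
    rw [hδ, hδ', hu ⟨x, hx⟩ hag (hv _ _ _ hρ hδ) (hv' _ _ _ hρ hδ')]
  · rw [FMap.get?_eq_none (hd ▸ hx : x ∉ δ.dom), FMap.get?_eq_none (hd' ▸ hx : x ∉ δ'.dom)]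

mutual
-- Structural recursion through closures, bodies and declarations. The statement allows two type
-- environments that agree on variables only, because candidates for a recursive environment are not
-- yet known to agree on functions. Statements need no clause: they contribute nothing to the return
-- type of a body.
theorem DVal.ty_unique : (v : DVal Loc Ext) → ∀ {β β' : TEnv} {τ τ' : DType}, LocAgree β β' →
    DValTy β v τ → DValTy β' v τ' → τ = τ'
  | .loc _ _, _, _, _, _, _, h, h' => by cases h; cases h'; rfl
  | .clo _ body, _, _, _, _, hβ, h, h' => by
    cases h with | clo f b =>
    cases h' with | clo f' b' =>
    cases f.unique f'
    rw [Body.ty_unique body (hβ.update _) b b']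

theorem Body.ty_unique : (b : Body Loc Ext) → ∀ {β β' : TEnv} {sT sT' : SType}, LocAgree β β' →
    BodyTy β b sT → BodyTy β' b sT' → sT = sT'
  | .letIn d _ _, _, _, _, _, hβ, h, h' => by
    cases h with | letIn hd _ he =>
    cases h' with | letIn hd' _ he' =>
    cases Decl.ty_unique d hβ hd hd'
    exact he.unique (hβ.update _) he'
  | .external _, _, _, _, _, _, h, h' => by cases h; cases h'; rfl

theorem Decl.ty_unique : (d : Decl Loc Ext) → ∀ {β β' δ δ' : TEnv}, LocAgree β β' →
    DeclTy β d δ → DeclTy β' d δ' → δ = δ'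
  | .nil, _, _, _, _, _, h, h' => by cases h; cases h'; rfl
  | .lvar _ _ _, _, _, _, _, _, h, h' => by cases h; cases h'; rfl
  | .seq d₀ d₁, _, _, _, _, hβ, h, h' => by
    cases h with | seq h₀ h₁ =>
    cases h' with | seq h₀' h₁' =>
    cases Decl.ty_unique d₀ hβ h₀ h₀'
    rw [Decl.ty_unique d₁ (hβ.update _) h₁ h₁']
  | .env _ ρ, _, _, _, _, _, h, h' => by
    cases h with | env h =>
    cases h' with | env h' =>
    exact h.unique_of_dval (fun x _ _ _ _ => DVal.ty_unique (ρ x)) h'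
  | .recEnv _ ρ, _, _, _, _, _, h, h' => by
    cases h with | recEnv h _ =>
    cases h' with | recEnv h' _ =>
    -- Typing an environment as a declaration ignores the ambient type environment, so the
    -- assumptions added by `rec` disappear and this case reduces to the previous one.
    cases h with | env h =>
    cases h' with | env h' =>
    exact h.unique_of_dval (fun x _ _ _ _ => DVal.ty_unique (ρ x)) h'
end

theorem DeclTy.unique {β δ δ' : TEnv} {d : Decl Loc Ext} (h : DeclTy β d δ)
    (h' : DeclTy β d δ') : δ = δ' :=
  Decl.ty_unique d (LocAgree.refl β) h h'

/-- An environment is itself a declaration, whose typing does not depend on the ambient type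
environment; the empty one is an arbitrary choice. -/
theorem EnvTy.unique {ρ : Env Loc Ext} {δ δ' : TEnv} (h : EnvTy ρ δ) (h' : EnvTy ρ δ') :
    δ = δ' :=
  DeclTy.unique (β := .empty) (d := Env.toDecl ρ) (.env h) (.env h')

theorem FMap.dom_single {V : Type u} (x : Ident) (v : V) : (FMap.single x v).dom = {x} := by
  ext; simp [FMap.single, FMap.ofFun]

theorem FMap.dom_update {V : Type u} (f g : FMap V) : (f.update g).dom = f.dom ∪ g.dom := by
  ext x
  rw [← FMap.get?_isSome, FMap.get?_update, Finset.mem_union]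
  split_ifs with h <;> simp [FMap.get?_isSome, h]

theorem GlobTy.dom_eq {β δ : TEnv} {g : Glob Loc Ext} (h : GlobTy β g δ) : δ.dom = g.DI := by
  induction h with
  | gvar => exact FMap.dom_single _ _
  | function => exact FMap.dom_single _ _
  | recG _ _ ih => exact ih
  | seq _ _ ih₀ ih₁ => rw [FMap.dom_update, ih₀, ih₁, Glob.DI]

/-- Both updates override the same identifiers, and with function types only. There neither side has
a location type, and elsewhere nothing changes. This handles the assumptions of `rec g`. -/
theorem LocAgree.update_restrict {β β' δ δ' : TEnv} (hβ : LocAgree β β') (hd : δ.dom = δ'.dom)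
    (h : ∀ x sT, δ.get? x ≠ some (.loc sT)) (h' : ∀ x sT, δ'.get? x ≠ some (.loc sT))
    (J : Finset Ident) : LocAgree (β.update (δ.restrict J)) (β'.update (δ'.restrict J)) := by
  have hm : ∀ (δ : TEnv) x, x ∈ (δ.restrict J).dom ↔ x ∈ J ∧ x ∈ δ.dom := by
    intro δ x
    rw [← FMap.get?_isSome, FMap.restrict, FMap.get?_ofFun]
    split_ifs with hx <;> simp [hx, FMap.get?_isSome]
  intro x sT
  rw [FMap.get?_update, FMap.get?_update]
  simp only [hm, hd]
  split_ifs with hx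
  · simp [FMap.restrict, FMap.get?_ofFun, hx.1, h, h']
  · exact hβ x sT

/-- In `rec g` the assumptions contain the produced function types, which may a priori differ
between the two derivations. They have the same domain and hide the same variables, so agreement on
variables survives and the induction hypothesis applies. -/
theorem Glob.ty_unique (g : Glob Loc Ext) {β β' δ δ' : TEnv} (hβ : LocAgree β β')
    (h : GlobTy β g δ) (h' : GlobTy β' g δ') : δ = δ' := by
  induction h generalizing β' δ' with
  | gvar => cases h'; rfl
  | function f b =>
    cases h' with | function f' b' =>
    cases f.unique f'
    rw [Body.ty_unique _ (hβ.update _) b b']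
  | recG h hn ih =>
    cases h' with | recG h' hn' =>
    exact ih (hβ.update_restrict (h.dom_eq.trans h'.dom_eq.symm) hn hn' _) h'
  | seq _ _ ih₀ ih₁ =>
    cases h' with | seq h₀ h₁ =>
    cases ih₀ hβ h₀
    rw [ih₁ (hβ.update _) h₁]

theorem GlobTy.unique {β δ δ' : TEnv} {g : Glob Loc Ext} (h : GlobTy β g δ)
    (h' : GlobTy β g δ') : δ = δ' :=
  Glob.ty_unique g (LocAgree.refl β) h h'

end TypingUniqueness

-- Concretization, soundness of the lifted operators, and the simulation predicate.

section Soundness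
variable {Loc Ext : Type u} {A : Carriers.{u}}

section Domains

theorem spair_val {A B : Type u} [SemilatticeSup A] [OrderBot A] [SemilatticeSup B] [OrderBot B]
    {a : A} {b : B} (ha : a ≠ ⊥) (hb : b ≠ ⊥) : (spair a b).1 = (a, b) :=
  congrArg Subtype.val (dif_pos ⟨ha, hb⟩ : spair a b = ⟨(a, b), _⟩)

variable (D : AbsDom Loc Ext A)

theorem AbsDom.bool_univ (t : Bool) : t ∈ D.bool.γ ⊤ :=
  (D.bool.gc Set.univ ⊤).1 le_top (Set.mem_univ t)

theorem AbsDom.bool_singleton (t : Bool) : t ∈ D.bool.γ (D.bool.α {t}) :=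
  D.bool.gc.le_u_l {t} rfl

theorem SValApprox.mono {v : SVal} {a b : SValA A} (hab : a ≤ b) (h : SValApprox D v a) :
    SValApprox D v b := by
  cases v with
  | int m => exact D.int.γ_mono hab.1 h
  | bool t => exact D.bool.gc.monotone_u hab.2 h

theorem ExcApprox.mono {ξ : Exc Ext} {a b : ExcA A} (hab : a ≤ b) (h : ExcApprox D ξ a) :
    ExcApprox D ξ b := by
  cases ξ with
  | rts χ => exact D.rts.γ_mono hab.1 h
  | val v => exact SValApprox.mono D hab.2 h

theorem ValStApprox.mono {υ : ValState Loc} {a b : ValStA A} (hab : a ≤ b)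
    (h : ValStApprox D υ a) : ValStApprox D υ b :=
  have hab : a.1 ≤ b.1 := hab
  ⟨SValApprox.mono D hab.1 h.1, D.mem.γ_mono hab.2 h.2⟩

theorem ExcStApprox.mono {ε : ExcState Loc Ext} {a b : ExcStA A} (hab : a ≤ b)
    (h : ExcStApprox D ε a) : ExcStApprox D ε b :=
  have hab : a.1 ≤ b.1 := hab
  ⟨D.mem.γ_mono hab.1 h.1, ExcApprox.mono D hab.2 h.2⟩

variable {D}

theorem ExcStApprox.left {ε : ExcState Loc Ext} {a : ExcStA A} (h : ExcStApprox D ε a)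
    (b : ExcStA A) : ExcStApprox D ε (a ⊔ b) := h.mono D le_sup_left

theorem ExcStApprox.right {ε : ExcState Loc Ext} {b : ExcStA A} (h : ExcStApprox D ε b)
    (a : ExcStA A) : ExcStApprox D ε (a ⊔ b) := h.mono D le_sup_right

theorem ValStApprox.left {υ : ValState Loc} {a : ValStA A} (h : ValStApprox D υ a)
    (b : ValStA A) : ValStApprox D υ (a ⊔ b) := h.mono D le_sup_left

theorem ValStApprox.right {υ : ValState Loc} {b : ValStA A} (h : ValStApprox D υ b)
    (a : ValStA A) : ValStApprox D υ (a ⊔ b) := h.mono D le_sup_right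

theorem AbsDom.mem_left {σ : Mem Loc} {a : A.MemA} (h : σ ∈ D.mem.γ a) (b : A.MemA) :
    σ ∈ D.mem.γ (a ⊔ b) := D.mem.γ_mono le_sup_left h

theorem AbsDom.mem_ne_bot {σ : Mem Loc} {a : A.MemA} (h : σ ∈ D.mem.γ a) : a ≠ ⊥ := by
  rintro rfl; rw [D.mem.γ_bot] at h; exact h

theorem SValApprox.ne_bot {v : SVal} {a : SValA A} (h : SValApprox D v a) : a ≠ ⊥ := by
  rintro rfl
  cases v with
  | int m => exact (D.int.γ_bot ▸ h : m ∈ (∅ : Set ℤ))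
  | bool t => exact (D.bool.γ_bot ▸ h : t ∈ (∅ : Set Bool))

theorem ExcApprox.ne_bot {ξ : Exc Ext} {a : ExcA A} (h : ExcApprox D ξ a) : a ≠ ⊥ := by
  rintro rfl
  cases ξ with
  | rts χ => exact (D.rts.γ_bot ▸ h : χ ∈ (∅ : Set (RTSExcept Ext)))
  | val v => exact SValApprox.ne_bot h rfl

/-- The smash product collapses a pair only if a component is `⊥`. Concretizations are strict, so
components that describe something are not `⊥`. -/
theorem ValStApprox.spair {v : SVal} {σ : Mem Loc} {a : SValA A} {b : A.MemA}
    (h : SValApprox D v a) (h' : σ ∈ D.mem.γ b) : ValStApprox D (v, σ) (spair a b) := by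
  unfold ValStApprox
  rw [spair_val h.ne_bot (AbsDom.mem_ne_bot h')]
  exact ⟨h, h'⟩

theorem ExcStApprox.spair {ξ : Exc Ext} {σ : Mem Loc} {a : ExcA A} {b : A.MemA}
    (h' : σ ∈ D.mem.γ b) (h : ExcApprox D ξ a) : ExcStApprox D (σ, ξ) (spair b a) := by
  unfold ExcStApprox
  rw [spair_val (AbsDom.mem_ne_bot h') h.ne_bot]
  exact ⟨h', h⟩

/-- Abstraction sends the full set to `⊤` for integers and run-time exceptions; for Booleans the
Galois connection gives the same conclusion. Used for external bodies, which may raise any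
exception. -/
theorem ExcApprox.top (ξ : Exc Ext) : ExcApprox D ξ ⊤ := by
  rcases ξ with χ | m | t
  · exact D.rts.α_sound _ _ D.rts.α_univ (Set.mem_univ χ)
  · exact D.int.α_sound _ _ D.int.α_univ (Set.mem_univ m)
  · exact D.bool_univ t

theorem SValApprox.alphaCon {c : SVal} {a : SValA A} (h : D.alphaCon c = some a) :
    SValApprox D c a := by
  cases c with
  | int m =>
    obtain ⟨m', hm, rfl⟩ := Option.map_eq_some_iff.1 h
    exact D.int.α_sound _ _ hm rfl
  | bool t => cases h; exact D.bool_singleton t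

theorem ExcApprox.alphaRts {χ : RTSExcept Ext} {a : ExcA A} (h : D.alphaRts χ = some a) :
    ExcApprox D (.rts χ) a := by
  obtain ⟨χ', hχ, rfl⟩ := Option.map_eq_some_iff.1 h
  exact D.rts.α_sound _ _ hχ rfl

theorem TmApprox.mono {q : Kind} {η : Tm Loc Ext q} {a b : ATm A Loc Ext q}
    (hab : ATm.Le A Loc Ext q a b) (h : TmApprox D η a) : TmApprox D η b := by
  cases q with
  | e =>
    rcases η with υ | ε
    · exact ValStApprox.mono D hab.1 h
    · exact ExcStApprox.mono D hab.2 h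
  | d =>
    rcases η with r | ε
    · exact ⟨Eq.trans h.1 hab.1, D.mem.γ_mono hab.2.1 h.2⟩
    · exact ExcStApprox.mono D hab.2.2 h
  | g =>
    rcases η with r | ε
    · exact ⟨Eq.trans h.1 hab.1, D.mem.γ_mono hab.2.1 h.2⟩
    · exact ExcStApprox.mono D hab.2.2 h
  | s =>
    rcases η with σ | ε
    · exact D.mem.γ_mono hab.1 h
    · exact ExcStApprox.mono D hab.2 h
  | b =>
    rcases η with σ | ε
    · exact D.mem.γ_mono hab.1 h
    · exact ExcStApprox.mono D hab.2 h
  | k =>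
    rcases η with (σ | ε) | ε
    · exact D.mem.γ_mono hab.1 h
    · exact ExcStApprox.mono D hab.2.1 h
    · exact ExcStApprox.mono D hab.2.2 h

theorem SValApprox.selA {v : SVal} {ε : ExcStA A} (h : SValApprox D v ε.1.2.2) :
    SValApprox D v (selA v.type ε) := by
  cases v <;> exact h

variable (D) in
/-- The sequents have the same environments and corresponding non-terminal configurations. -/
inductive Corr : Sequent Loc Ext → ASequent A Loc Ext → Prop
  | pos {q ρ β N η NA ηA} : NTApprox D N NA → Corr (.pos q ρ β N η) (.mk q ρ β NA ηA)
  | neg {q ρ β N NA ηA} : NTApprox D N NA → Corr (.neg q ρ β N) (.mk q ρ β NA ηA)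

theorem SeqApprox.tm {q : Kind} {ρ β} {N : NT Loc Ext q} {η : Tm Loc Ext q}
    {NA : ANT A Loc Ext q} {ηA : ATm A Loc Ext q}
    (h : SeqApprox D (.pos q ρ β N η) (.mk q ρ β NA ηA)) : TmApprox D η ηA := by
  cases h; assumption

end Domains

variable {M : MemImpl Loc} {D : AbsSem Ext M A}

theorem AbsSem.unmarkEA_sound {ε ε' : ExcState Loc Ext} {εA : ExcStA A}
    (h : ExcStApprox D.toAbsDom ε εA) (hu : UnmarkE ε ε') :
    ExcStApprox D.toAbsDom ε' (D.unmarkEA εA) := by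
  obtain ⟨σ', ξ'⟩ := ε'
  obtain rfl : ξ' = ε.2 := hu.2
  exact .spair (D.unmarkA_sound _ _ h.1 _ hu.1) h.2

theorem AbsSem.unlinkEA_sound {ε ε' : ExcState Loc Ext} {εA : ExcStA A}
    (h : ExcStApprox D.toAbsDom ε εA) (hu : UnlinkE ε ε') :
    ExcStApprox D.toAbsDom ε' (D.unlinkEA εA) := by
  obtain ⟨σ', ξ'⟩ := ε'
  obtain rfl : ξ' = ε.2 := hu.2
  exact .spair (D.unlinkA_sound _ _ h.1 _ hu.1) h.2

theorem AbsSem.unmarkT_sound {η η' : Mem Loc ⊕ ExcState Loc Ext} {σA : A.MemA} {εA : ExcStA A}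
    (h : MemApprox D.toAbsDom η (σA, εA)) (hu : UnmarkT η η') :
    MemApprox D.toAbsDom η' (D.unmarkA σA, D.unmarkEA εA) := by
  cases hu with
  | inl hu => exact D.unmarkA_sound _ _ h _ hu
  | inr hu => exact D.unmarkEA_sound h hu

theorem MemApprox.mono {η : Mem Loc ⊕ ExcState Loc Ext} {σ σ' : A.MemA} {ε ε' : ExcStA A}
    (h : MemApprox D.toAbsDom η (σ, ε)) (hσ : σ ≤ σ') (hε : ε ≤ ε') :
    MemApprox D.toAbsDom η (σ', ε') :=
  TmApprox.mono (q := .s) (a := (σ, ε)) (b := (σ', ε')) ⟨hσ, hε⟩ h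

theorem MemApprox.sup_right {η : Mem Loc ⊕ ExcState Loc Ext} {σ : A.MemA} {ε : ExcStA A}
    (h : MemApprox D.toAbsDom η (σ, ε)) (σ' : A.MemA) (ε' : ExcStA A) :
    MemApprox D.toAbsDom η (σ' ⊔ σ, ε' ⊔ ε) :=
  h.mono le_sup_right le_sup_right

theorem MemApprox.sup_left {η : Mem Loc ⊕ ExcState Loc Ext} {σ : A.MemA} {ε : ExcStA A}
    (h : MemApprox D.toAbsDom η (σ, ε)) (σ' : A.MemA) (ε' : ExcStA A) :
    MemApprox D.toAbsDom η (σ ⊔ σ', ε ⊔ ε') :=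
  h.mono le_sup_left le_sup_left

theorem MemApprox.exc_right {η : Mem Loc ⊕ ExcState Loc Ext} {σ : A.MemA} {ε : ExcStA A}
    (h : MemApprox D.toAbsDom η (σ, ε)) (ε' : ExcStA A) :
    MemApprox D.toAbsDom η (σ, ε' ⊔ ε) :=
  h.mono le_rfl le_sup_right

theorem MemApprox.exc_left {η : Mem Loc ⊕ ExcState Loc Ext} {σ : A.MemA} {ε : ExcStA A}
    (h : MemApprox D.toAbsDom η (σ, ε)) (ε' : ExcStA A) :
    MemApprox D.toAbsDom η (σ, ε ⊔ ε') :=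
  h.mono le_rfl le_sup_left

theorem ValApprox.sup_right {η : ValState Loc ⊕ ExcState Loc Ext} {υ : ValStA A} {ε : ExcStA A}
    (h : ValApprox D.toAbsDom η (υ, ε)) (υ' : ValStA A) (ε' : ExcStA A) :
    ValApprox D.toAbsDom η (υ' ⊔ υ, ε' ⊔ ε) := by
  cases η with
  | inl => exact ValStApprox.right h _
  | inr => exact ExcStApprox.right h _

/-- The filter of a guard that may evaluate to false. -/
theorem AbsSem.φ_not_sound {e : Exp} {β : TEnv} {ρ : Env Loc Ext} {σA : A.MemA}
    (he : ExpTy β e .boolean) (hρ : Compat ρ β) {σ : Mem Loc} (hσ : σ ∈ D.mem.γ σA)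
    {σ' : Mem Loc} (h : Derivable M (evE ρ β e σ (.inl (.bool false, σ')))) :
    σ' ∈ D.mem.γ (D.φ ρ σA (.not e)) := by
  -- The filter only speaks of evaluations to true, so the derivation for `e` is extended by one
  -- rule to a derivation for its negation.
  refine D.φ_sound _ _ _ _ (.not he) hρ σ hσ σ' ?_
  refine .mk ⟨.not_ok (t := false), ?_, hρ, _, .not he⟩ ?_ <;>
    simp only [List.mem_singleton, forall_eq]
  · exact ⟨hρ, _, he⟩
  · exact h

/-- The concrete premises correspond to abstract premises, each one provided that the
preceding ones are derivable and approximated; if all of them are, then `G` holds. -/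
def Sim (D : AbsSem Ext M A) (psA : List (ASequent A Loc Ext)) (G : Prop) :
    List (Sequent Loc Ext) → Prop
  | [] => G
  | p :: ps => ∃ pA ∈ psA, Corr D.toAbsDom p pA ∧
      (Derivable M p → SeqApprox D.toAbsDom p pA → Sim D psA G ps)

/-- Constructs and environments already coincide, so only the description of the initial state
remains to be checked. The partner is any member of the abstract premises, not the one in the same
position: an abstract rule evaluates all branches, a concrete one only some. -/
theorem Sim.step {psA : List (ASequent A Loc Ext)} {G : Prop} {ps : List (Sequent Loc Ext)}
    {q : Kind} {ρ : Env Loc Ext} {β : TEnv} {c : Con Loc Ext q} {x : InSt Loc Ext q}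
    {xA : AInSt A q} {η : Tm Loc Ext q} {ηA : ATm A Loc Ext q}
    (hmem : ASequent.mk q ρ β (c, xA) ηA ∈ psA) (hx : InStApprox D.toAbsDom q x xA)
    (k : Derivable M (.pos q ρ β (c, x) η) → TmApprox D.toAbsDom η ηA → Sim D psA G ps) :
    Sim D psA G (.pos q ρ β (c, x) η :: ps) :=
  ⟨_, hmem, .pos ⟨rfl, hx⟩, fun hd h => k hd h.tm⟩

end Soundness

-- One-step simulation of the concrete rules by the abstract schemata.

section Simulation
variable {Loc Ext : Type u} {A : Carriers.{u}} {M : MemImpl Loc} {D : AbsSem Ext M A}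

theorem PosRule.sim_exp {ps : List (Sequent Loc Ext)} {psA : List (ASequent A Loc Ext)}
    {ρ : Env Loc Ext} {β : TEnv} {e : Exp} {σ : Mem Loc} {η : ValState Loc ⊕ ExcState Loc Ext}
    {σA : A.MemA} {ηA : ValStA A × ExcStA A}
    (h : PosRule M ps (evE ρ β e σ η)) (hA : AbsSchema D psA (avE ρ β e σA ηA))
    (hσ : σ ∈ D.mem.γ σA) (hρ : Compat ρ β) (ht : ∃ sT, ExpTy β e sT) :
    Sim D psA (ValApprox D.toAbsDom η ηA) ps := by
  obtain ⟨sT, ht⟩ := ht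
  cases h with
  | con => cases hA with | con hc => exact ValStApprox.spair (.alphaCon hc) hσ
  | var hx =>
    cases hA with | var hx' =>
    cases hx.symm.trans hx'
    exact D.readA_sound _ _ _ _ hσ
  | neg_err => cases hA with | neg _ => exact .step (.head _) hσ fun _ h => h
  | neg_ok =>
    cases hA with | neg _ =>
    exact .step (.head _) hσ fun _ h => ValStApprox.spair (D.negA_sound _ _ h.1) h.2
  | arith_err₀ =>
    cases hA with
    | arith => exact .step (.head _) hσ fun _ h => ExcStApprox.left h _
    | arith_exc =>
      exact .step (.head _) hσ fun _ h => ExcStApprox.left (ExcStApprox.left h _) _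
  | arith_err₁ =>
    cases hA with
    | arith =>
      exact .step (.head _) hσ fun _ h₀ => .step (.tail _ (.head _)) h₀.2 fun _ h =>
        ExcStApprox.right h _
    | arith_exc =>
      exact .step (.head _) hσ fun _ h₀ => .step (.tail _ (.head _)) h₀.2 fun _ h =>
        ExcStApprox.left (ExcStApprox.right h _) _
  | arith_ok hd =>
    cases hA with
    | arith =>
      exact .step (.head _) hσ fun _ h₀ => .step (.tail _ (.head _)) h₀.2 fun _ h =>
        ValStApprox.spair (D.arithA_sound _ _ _ _ h₀.1 _ h.1 hd) h.2
    | arith_exc =>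
      exact .step (.head _) hσ fun _ h₀ => .step (.tail _ (.head _)) h₀.2 fun _ h =>
        ValStApprox.spair (D.arithA_sound _ _ _ _ h₀.1 _ h.1 hd) h.2
  | arith_exc hd =>
    cases hA with
    | arith _ _ hd' =>
      exact .step (.head _) hσ fun _ h₀ => .step (.tail _ (.head _)) h₀.2 fun _ h =>
        -- A divisor evaluating to `0` is described by the abstract divisor, contrary to the side
        -- condition of the schema without the exception.
        False.elim (hd'.elim (fun h' => h' hd) fun h' => h' h.1)
    | arith_exc _ _ _ _ hξ =>
      exact .step (.head _) hσ fun _ h₀ => .step (.tail _ (.head _)) h₀.2 fun _ h =>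
        ExcStApprox.right (ExcStApprox.spair h.2 (.alphaRts hξ)) _
  | test_err₀ =>
    cases hA with | test =>
    exact .step (.head _) hσ fun _ h => ExcStApprox.left h _
  | test_err₁ =>
    cases hA with | test =>
    exact .step (.head _) hσ fun _ h₀ => .step (.tail _ (.head _)) h₀.2 fun _ h =>
      ExcStApprox.right h _
  | test_ok =>
    cases hA with | test =>
    exact .step (.head _) hσ fun _ h₀ => .step (.tail _ (.head _)) h₀.2 fun _ h =>
      ValStApprox.spair (D.testA_sound _ _ _ _ h₀.1 _ h.1) h.2
  | not_err => cases hA with | not => exact .step (.head _) hσ fun _ h => h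
  | not_ok =>
    cases hA with | not _ =>
    exact .step (.head _) hσ fun _ h => ValStApprox.spair (D.notA_sound _ _ h.1) h.2
  | and_err =>
    cases hA with | and =>
    exact .step (.head _) hσ fun _ h => ExcStApprox.left h _
  | and_ff =>
    cases hA with | and hv =>
    cases ht with | and ht _ =>
    -- The abstract value of the first operand is discarded: its derivation `hd` shows that the
    -- memory after it lies in the filtered one.
    exact .step (.head _) hσ fun hd _ =>
      ValStApprox.left (.spair (.alphaCon hv) (D.φ_not_sound ht hρ hσ hd)) _
  | and_tt =>
    cases hA with | and hv =>
    cases ht with | and ht _ =>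
    exact .step (.head _) hσ fun hd _ =>
      .step (.tail _ (.head _)) (D.φ_sound _ _ _ _ ht hρ _ hσ _ hd) fun _ h =>
        ValApprox.sup_right h _ _
  | or_err =>
    cases hA with | or =>
    exact .step (.head _) hσ fun _ h => ExcStApprox.left h _
  | or_tt =>
    cases hA with | or hv =>
    cases ht with | or ht _ =>
    exact .step (.head _) hσ fun hd _ =>
      ValStApprox.left (.spair (.alphaCon hv) (D.φ_sound _ _ _ _ ht hρ _ hσ _ hd)) _
  | or_ff =>
    cases hA with | or hv =>
    cases ht with | or ht _ =>
    exact .step (.head _) hσ fun hd _ =>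
      .step (.tail _ (.head _)) (D.φ_not_sound ht hρ hσ hd) fun _ h =>
        ValApprox.sup_right h _ _

/-- The declaration is a function application rather than a constructor applied to variables, so it
is generalised before inverting the schema; the environment is recovered from its domain and values.
-/
theorem AbsSchema.toDecl_inv {psA : List (ASequent A Loc Ext)} {ρ ρ₀ : Env Loc Ext} {β : TEnv}
    {σA : A.MemA} {ηA : (Env Loc Ext × A.MemA) × ExcStA A}
    (hA : AbsSchema D psA (avD ρ β ρ₀.toDecl σA ηA)) : ηA = ((ρ₀, σA), ⊥) := by
  generalize hd : ρ₀.toDecl = d at hA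
  cases hA with
  | env => cases ρ₀; cases hd; rfl
  | _ => cases hd

theorem AbsSchema.toRecDecl_inv {psA : List (ASequent A Loc Ext)} {ρ ρ₀ : Env Loc Ext}
    {β : TEnv} {σA : A.MemA} {ηA : (Env Loc Ext × A.MemA) × ExcStA A}
    (hA : AbsSchema D psA (avD ρ β ρ₀.toRecDecl σA ηA)) : ηA = ((unfoldRec ρ₀, σA), ⊥) := by
  generalize hd : ρ₀.toRecDecl = d at hA
  cases hA with
  | recEnv => cases ρ₀; cases hd; rfl
  | _ => cases hd

/-- In a sequence, the second premises are sequents over the same environments only because the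
environments produced by the first declaration are equal by approximation, and its type environments
by uniqueness. -/
theorem PosRule.sim_decl {ps : List (Sequent Loc Ext)} {psA : List (ASequent A Loc Ext)}
    {ρ : Env Loc Ext} {β : TEnv} {d : Decl Loc Ext} {σ : Mem Loc}
    {η : (Env Loc Ext × Mem Loc) ⊕ ExcState Loc Ext}
    {σA : A.MemA} {ηA : (Env Loc Ext × A.MemA) × ExcStA A}
    (h : PosRule M ps (evD ρ β d σ η)) (hA : AbsSchema D psA (avD ρ β d σA ηA))
    (hσ : σ ∈ D.mem.γ σA) : Sim D psA (EnvApprox D.toAbsDom η ηA) ps := by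
  cases h with
  | nil => cases hA with | nil => exact ⟨rfl, hσ⟩
  | env => cases hA.toDecl_inv; exact ⟨rfl, hσ⟩
  | recEnv => cases hA.toRecDecl_inv; exact ⟨rfl, hσ⟩
  | lvar_err hu =>
    cases hA with | lvar hn =>
    exact .step (.head _) hσ fun _ h => D.unmarkEA_sound (ExcStApprox.left h _) hu
  | lvar_stk_err hn' hu =>
    cases hA with | lvar hn =>
    exact .step (.head _) hσ fun _ h =>
      D.unmarkEA_sound (ExcStApprox.right ((D.newSA_sound _ _ _ _ hn _ h).2 _ hn') _) hu
  | lvar_ok hn' =>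
    cases hA with | lvar hn =>
    refine .step (.head _) hσ fun _ h => ?_
    -- The abstract allocation returns the concrete address, so both rules bind the identifier to
    -- the same denotable value.
    obtain ⟨h₁, rfl⟩ := (D.newSA_sound _ _ _ _ hn _ h).1 _ _ hn'
    exact ⟨rfl, h₁⟩
  | dseq_err₀ =>
    cases hA with | dseq =>
    exact .step (.head _) hσ fun _ h => ExcStApprox.left h _
  | dseq_err₁ hβ =>
    cases hA with | dseq hβ' =>
    cases hβ.unique hβ'
    refine .step (.head _) hσ fun _ h₀ => ?_
    obtain ⟨rfl, h₀⟩ := h₀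
    exact .step (.tail _ (.head _)) h₀ fun _ h => ExcStApprox.right h _
  | dseq_ok hβ =>
    cases hA with | dseq hβ' =>
    cases hβ.unique hβ'
    refine .step (.head _) hσ fun _ h₀ => ?_
    obtain ⟨rfl, h₀⟩ := h₀
    refine .step (.tail _ (.head _)) h₀ fun _ h => ?_
    obtain ⟨rfl, h⟩ := h
    exact ⟨rfl, h⟩

theorem PosRule.sim_glob {ps : List (Sequent Loc Ext)} {psA : List (ASequent A Loc Ext)}
    {ρ : Env Loc Ext} {β : TEnv} {g : Glob Loc Ext} {σ : Mem Loc}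
    {η : (Env Loc Ext × Mem Loc) ⊕ ExcState Loc Ext}
    {σA : A.MemA} {ηA : (Env Loc Ext × A.MemA) × ExcStA A}
    (h : PosRule M ps (evG ρ β g σ η)) (hA : AbsSchema D psA (avG ρ β g σA ηA))
    (hσ : σ ∈ D.mem.γ σA) : Sim D psA (EnvApprox D.toAbsDom η ηA) ps := by
  cases h with
  | gvar_err =>
    cases hA with | gvar hn =>
    exact .step (.head _) hσ fun _ h => D.cleanupDA_sound _ _ (ExcStApprox.left h _)
  | gvar_dat_err hn' =>
    cases hA with | gvar hn =>
    exact .step (.head _) hσ fun _ h =>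
      D.cleanupDA_sound _ _ (ExcStApprox.right ((D.newDA_sound _ _ _ _ hn _ h).2 _ hn') _)
  | gvar_ok hn' =>
    cases hA with | gvar hn =>
    refine .step (.head _) hσ fun _ h => ?_
    obtain ⟨h₁, rfl⟩ := (D.newDA_sound _ _ _ _ hn _ h).1 _ _ hn'
    exact ⟨rfl, h₁⟩
  | function => cases hA with | function => exact ⟨rfl, hσ⟩
  | recG hβ =>
    cases hA with | recG hβ' =>
    cases hβ.unique hβ'
    refine .step (.head _) hσ fun _ h₀ => ?_
    obtain ⟨rfl, h₀⟩ := h₀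
    exact .step (.tail _ (.head _)) h₀ fun _ h => h
  | gseq_err₀ =>
    cases hA with | gseq =>
    exact .step (.head _) hσ fun _ h => ExcStApprox.left h _
  | gseq_err₁ hβ =>
    cases hA with | gseq hβ' =>
    cases hβ.unique hβ'
    refine .step (.head _) hσ fun _ h₀ => ?_
    obtain ⟨rfl, h₀⟩ := h₀
    exact .step (.tail _ (.head _)) h₀ fun _ h => ExcStApprox.right h _
  | gseq_ok hβ =>
    cases hA with | gseq hβ' =>
    cases hβ.unique hβ'
    refine .step (.head _) hσ fun _ h₀ => ?_
    obtain ⟨rfl, h₀⟩ := h₀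
    refine .step (.tail _ (.head _)) h₀ fun _ h => ?_
    obtain ⟨rfl, h⟩ := h
    exact ⟨rfl, h⟩

theorem PosRule.sim_stmt {ps : List (Sequent Loc Ext)} {psA : List (ASequent A Loc Ext)}
    {ρ : Env Loc Ext} {β : TEnv} {s : Stmt Loc Ext} {σ : Mem Loc}
    {η : Mem Loc ⊕ ExcState Loc Ext} {σA : A.MemA} {ηA : A.MemA × ExcStA A}
    (h : PosRule M ps (evS ρ β s σ η)) (hA : AbsSchema D psA (avS ρ β s σA ηA))
    (hσ : σ ∈ D.mem.γ σA) (hρ : Compat ρ β) (ht : StmtTy β s) :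
    Sim D psA (MemApprox D.toAbsDom η ηA) ps := by
  cases h with
  | nop => cases hA with | nop => exact hσ
  | assign_err =>
    cases hA with | assign =>
    exact .step (.head _) hσ fun _ h => ExcStApprox.left h _
  | assign_ok hx hw =>
    cases hA with | assign hx' =>
    cases hx.symm.trans hx'
    exact .step (.head _) hσ fun _ h =>
      MemApprox.exc_right (D.writeA_sound _ _ _ _ _ h.2 _ h.1 _ hw) _
  | sseq_err =>
    cases hA with | sseq =>
    exact .step (.head _) hσ fun _ h => ExcStApprox.left h _
  | sseq_ok =>
    cases hA with | sseq =>
    exact .step (.head _) hσ fun _ h₀ => .step (.tail _ (.head _)) h₀ fun _ h =>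
      MemApprox.exc_right h _
  | block_err =>
    cases hA with | block =>
    exact .step (.head _) (D.markA_sound _ _ hσ) fun _ h => ExcStApprox.left h _
  | block_ok hβ hu =>
    cases hA with | block hβ' =>
    cases hβ.unique hβ'
    refine .step (.head _) (D.markA_sound _ _ hσ) fun _ h₀ => ?_
    obtain ⟨rfl, h₀⟩ := h₀
    exact .step (.tail _ (.head _)) h₀ fun _ h => MemApprox.exc_right (D.unmarkT_sound h hu) _
  | ite_err =>
    cases hA with | ite =>
    exact .step (.head _) hσ fun _ h => ExcStApprox.left (ExcStApprox.left h _) _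
  | ite_tt =>
    cases hA with | ite =>
    cases ht with | ite ht =>
    exact .step (.head _) hσ fun hd _ =>
      .step (.tail _ (.head _)) (D.φ_sound _ _ _ _ ht hρ _ hσ _ hd) fun _ h =>
        MemApprox.sup_left (MemApprox.exc_right h _) _ _
  | ite_ff =>
    cases hA with | ite =>
    cases ht with | ite ht =>
    exact .step (.head _) hσ fun hd _ =>
      -- The else branch is the second concrete premise but the third abstract one.
      .step (.tail _ (.tail _ (.head _))) (D.φ_not_sound ht hρ hσ hd) fun _ h =>
        MemApprox.sup_right h _ _
  | while_guard_err =>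
    cases hA with | whileDo =>
    exact .step (.head _) hσ fun _ h => ExcStApprox.left (ExcStApprox.left h _) _
  | while_ff =>
    cases hA with | whileDo =>
    cases ht with | whileDo ht =>
    exact .step (.head _) hσ fun hd _ => AbsDom.mem_left (D.φ_not_sound ht hρ hσ hd) _
  | while_body_err =>
    cases hA with | whileDo =>
    cases ht with | whileDo ht =>
    exact .step (.head _) hσ fun hd _ =>
      .step (.tail _ (.head _)) (D.φ_sound _ _ _ _ ht hρ _ hσ _ hd) fun _ h =>
        ExcStApprox.left (ExcStApprox.right h _) _
  | while_body_ok =>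
    cases hA with | whileDo =>
    cases ht with | whileDo ht =>
    -- The remaining iterations are one premise on each side, so no loop invariant or induction is
    -- needed here.
    exact .step (.head _) hσ fun hd _ =>
      .step (.tail _ (.head _)) (D.φ_sound _ _ _ _ ht hρ _ hσ _ hd) fun _ h₁ =>
        .step (.tail _ (.tail _ (.head _))) h₁ fun _ h => MemApprox.sup_right h _ _
  | throwRts => cases hA with | throwRts hξ => exact ExcStApprox.spair hσ (.alphaRts hξ)
  | throw_err =>
    cases hA with | throwExp =>
    exact .step (.head _) hσ fun _ h => ExcStApprox.left h _
  | throw_ok =>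
    cases hA with | throwExp =>
    exact .step (.head _) hσ fun _ h =>
      ExcStApprox.right (ExcStApprox.spair h.2 (show ExcApprox _ (.val _) (⊥, _) from h.1)) _
  | try_ok =>
    cases hA with | tryCatch =>
    exact .step (.head _) hσ fun _ h => AbsDom.mem_left h _
  | try_caught =>
    cases hA with | tryCatch =>
    exact .step (.head _) hσ fun _ h₀ => .step (.tail _ (.head _)) h₀ fun _ h =>
      MemApprox.mono h le_sup_right le_sup_left
  | try_uncaught =>
    cases hA with | tryCatch =>
    exact .step (.head _) hσ fun _ h₀ => .step (.tail _ (.head _)) h₀ fun _ h =>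
      ExcStApprox.right h _
  | finally_ok =>
    cases hA with | tryFinally =>
    exact .step (.head _) hσ fun _ h₀ => .step (.tail _ (.head _)) h₀ fun _ h =>
      MemApprox.exc_left (MemApprox.exc_left h _) _
  | finally_exc₀ =>
    cases hA with | tryFinally =>
    -- With a pending exception, the `finally` part matches the abstract premise started on the
    -- memory of the exception component; its outcome is paired again with the pending exception,
    -- described by `h₀.2`.
    exact .step (.head _) hσ fun _ h₀ => .step (.tail _ (.tail _ (.head _))) h₀.1 fun _ h =>
      ExcStApprox.right (ExcStApprox.spair h h₀.2) _
  | finally_exc₁ =>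
    cases hA with | tryFinally =>
    exact .step (.head _) hσ fun _ h₀ => .step (.tail _ (.tail _ (.head _))) h₀.1 fun _ h =>
      ExcStApprox.left (ExcStApprox.right h _) _
  | call_param_err hf hc =>
    cases hA with | call hf' hc' =>
    cases hf.symm.trans hf'
    cases hc.symm.trans hc'
    exact .step (.head _) (D.markA_sound _ _ hσ) fun _ h =>
      ExcStApprox.left (ExcStApprox.left h _) _
  | call_eval_err hf hc h₀ h₁ hl hu hu' =>
    cases hA with | call hf' hc' h₀' h₁' =>
    cases hf.symm.trans hf'
    cases hc.symm.trans hc'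
    cases h₁.unique h₁'
    refine .step (.head _) (D.markA_sound _ _ hσ) fun _ h => ?_
    obtain ⟨rfl, h⟩ := h
    exact .step (.tail _ (.head _)) (D.linkA_sound _ _ h _ hl) fun _ h =>
      ExcStApprox.left (ExcStApprox.right
        (D.unmarkEA_sound (D.unlinkEA_sound h hu) hu') _) _
  | call_ok hf hc h₀ h₁ hl hu hu' =>
    cases hA with | call hf' hc' h₀' h₁' =>
    cases hf.symm.trans hf'
    cases hc.symm.trans hc'
    cases h₁.unique h₁'
    refine .step (.head _) (D.markA_sound _ _ hσ) fun _ h => ?_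
    obtain ⟨rfl, h⟩ := h
    -- Possible only now: `h₀` and `h₀'` type the same environment once the first premise has
    -- identified the two results.
    cases h₀.unique h₀'
    exact .step (.tail _ (.head _)) (D.linkA_sound _ _ h _ hl) fun _ h =>
      .step (.tail _ (.tail _ (.head _))) (D.unlinkA_sound _ _ h _ hu) fun _ h =>
        MemApprox.exc_right (D.unmarkT_sound h hu') _

theorem PosRule.sim_body {ps : List (Sequent Loc Ext)} {psA : List (ASequent A Loc Ext)}
    {ρ : Env Loc Ext} {β : TEnv} {b : Body Loc Ext} {σ : Mem Loc}
    {η : Mem Loc ⊕ ExcState Loc Ext} {σA : A.MemA} {ηA : A.MemA × ExcStA A}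
    (h : PosRule M ps (evB ρ β b σ η)) (hA : AbsSchema D psA (avB ρ β b σA ηA))
    (hσ : σ ∈ D.mem.γ σA) : Sim D psA (MemApprox D.toAbsDom η ηA) ps := by
  cases h with
  | body_err₀ =>
    cases hA with | letIn =>
    exact .step (.head _) (D.markA_sound _ _ hσ) fun _ h => ExcStApprox.left h _
  | body_err₁ hβ hu =>
    cases hA with | letIn hβ' =>
    cases hβ.unique hβ'
    refine .step (.head _) (D.markA_sound _ _ hσ) fun _ h => ?_
    obtain ⟨rfl, h⟩ := h
    exact .step (.tail _ (.head _)) h fun _ h =>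
      ExcStApprox.right (D.unmarkEA_sound (ExcStApprox.left h _) hu) _
  | body_ok hβ hu =>
    cases hA with | letIn hβ' =>
    cases hβ.unique hβ'
    refine .step (.head _) (D.markA_sound _ _ hσ) fun _ h => ?_
    obtain ⟨rfl, h⟩ := h
    exact .step (.tail _ (.head _)) h fun _ h => .step (.tail _ (.tail _ (.head _))) h fun _ h =>
      MemApprox.exc_right (D.unmarkT_sound (MemApprox.exc_right h _) hu) _
  | external_ok hs => cases hA with | external h => exact h _ _ hs hσ
  | external_exc hs =>
    cases hA with | external h => exact ExcStApprox.spair (h _ _ hs hσ) (.top _)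

theorem PosRule.sim_catch {ps : List (Sequent Loc Ext)} {psA : List (ASequent A Loc Ext)}
    {ρ : Env Loc Ext} {β : TEnv} {k : Catch Loc Ext} {ε : ExcState Loc Ext}
    {η : (Mem Loc ⊕ ExcState Loc Ext) ⊕ ExcState Loc Ext} {εA : ExcStA A}
    {ηA : (A.MemA × ExcStA A) × ExcStA A}
    (h : PosRule M ps (evK ρ β k ε η)) (hA : AbsSchema D psA (avK ρ β k εA ηA))
    (hε : ExcStApprox D.toAbsDom ε εA) : Sim D psA (CatchApprox D.toAbsDom η ηA) ps := by
  cases h with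
  | catch_caught hp hm =>
    cases hA with
    | clause => exact .step (.head _) (D.φpos_sound _ _ _ hε hm).1 fun _ h => h
    | clause_var => exact absurd trivial hp
  | catch_var_stk_err hv hn hu =>
    cases hA with
    | clause hp => exact absurd trivial hp
    | clause_var hn' =>
      subst hv
      -- The schema filters by the type instead of by `x : T`; both catch exactly the exceptions of
      -- that type, so the match holds by definition.
      have h := D.φpos_sound (.ty (.st _)) _ _ hε rfl
      exact ExcStApprox.left (D.unmarkEA_sound ((D.newSA_sound _ _ _ _ hn' _
        (.spair (SValApprox.selA h.2) (D.markA_sound _ _ h.1))).2 _ hn) hu) _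
  | catch_var_ok hv hn hu =>
    cases hA with
    | clause hp => exact absurd trivial hp
    | clause_var hn' =>
      subst hv
      have h := D.φpos_sound (.ty (.st _)) _ _ hε rfl
      obtain ⟨h, rfl⟩ := (D.newSA_sound _ _ _ _ hn' _
        (.spair (SValApprox.selA h.2) (D.markA_sound _ _ h.1))).1 _ _ hn
      exact .step (.head _) h fun _ h => MemApprox.exc_right (D.unmarkT_sound h hu) _
  | catch_uncaught hm =>
    cases hA with
    | clause => exact D.φneg_sound _ _ _ hε hm
    | clause_var => exact D.φneg_sound (.ty _) _ _ hε hm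
  | kseq_caught =>
    cases hA with | kseq =>
    exact .step (.head _) hε fun _ h => MemApprox.sup_left h _ _
  | kseq_uncaught =>
    cases hA with | kseq =>
    refine .step (.head _) hε fun _ h => .step (.tail _ (.head _)) h fun _ h => ?_
    -- The caught results of the two clauses are joined, while what remains uncaught is that of the
    -- second clause alone.
    rcases η with η | ε'
    · exact MemApprox.sup_right h _ _
    · exact h

theorem PosRule.sim {ps : List (Sequent Loc Ext)} {psA : List (ASequent A Loc Ext)} {q : Kind}
    {ρ : Env Loc Ext} {β : TEnv} {N : NT Loc Ext q} {η : Tm Loc Ext q} {NA : ANT A Loc Ext q}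
    {ηA : ATm A Loc Ext q} (h : PosRule M ps (.pos q ρ β N η))
    (hA : AbsSchema D psA (.mk q ρ β NA ηA)) (hN : NTApprox D.toAbsDom N NA)
    (hρ : Compat ρ β) (ht : WellTyped β q N.1) : Sim D psA (TmApprox D.toAbsDom η ηA) ps := by
  obtain ⟨c, x⟩ := N
  obtain ⟨c', xA⟩ := NA
  obtain ⟨hc, hx⟩ := hN
  obtain rfl : c = c' := hc
  cases q with
  | e => exact h.sim_exp hA hx hρ ht
  | d => exact h.sim_decl hA hx
  | g => exact h.sim_glob hA hx
  | s => exact h.sim_stmt hA hx hρ ht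
  | b => exact h.sim_body hA hx
  | k => exact h.sim_catch hA hx

end Simulation

-- Immediate subtrees and their roots.

namespace Tree
variable {S : Type u}

theorem Roots.exists_tree {ts : List (Tree S)} {ps : List S} (h : Roots ts ps) {p : S}
    (hp : p ∈ ps) : ∃ t ∈ ts, t.root = some p := by
  induction h with
  | nil => cases hp
  | cons ht _ ih =>
    cases hp with
    | head => exact ⟨_, .head _, ht⟩
    | tail _ hp =>
      obtain ⟨t, h, h'⟩ := ih hp
      exact ⟨t, .tail _ h, h'⟩

theorem Node.sub_mem {θ : Tree S} {ts : List (Tree S)} {s : S} (h : θ.Node ts s) {i : ℕ}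
    (hi : (θ.label [i]).isSome) : θ.sub [i] ∈ ts := by
  have hlt := (h.2.1 i).1 hi
  rw [h.2.2 i hlt]
  exact List.getElem_mem hlt

theorem Node.exists_sub {θ : Tree S} {ts : List (Tree S)} {s : S} (h : θ.Node ts s) {t : Tree S}
    (ht : t ∈ ts) : ∃ j, (θ.label [j]).isSome ∧ θ.sub [j] = t := by
  obtain ⟨j, hj, rfl⟩ := List.getElem_of_mem ht
  exact ⟨j, (h.2.1 j).2 hj, h.2.2 j hj⟩

end Tree

-- From rules to trees: induction on positive trees, coinduction on pairs of trees.

section TreeSoundness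
variable {Loc Ext : Type u} {A : Carriers.{u}} {M : MemImpl Loc} {D : AbsSem Ext M A}

theorem posTrees_unfold {θ : Tree (Sequent Loc Ext)} (h : θ ∈ PosTrees M) :
    θ ∈ Fpos M (PosTrees M) := by
  rw [PosTrees, OrderHom.map_lfp]; exact h

theorem negTrees_unfold {θ : Tree (Sequent Loc Ext)} (h : θ ∈ NegTrees M) :
    θ ∈ Fneg M (NegTrees M) := by
  rw [NegTrees, OrderHom.map_gfp]; exact h

theorem abstractTrees_unfold {θ : Tree (ASequent A Loc Ext)} (h : θ ∈ AbstractTrees D) :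
    θ ∈ Fabs D (AbstractTrees D) := by
  rw [AbstractTrees, OrderHom.map_gfp]; exact h

theorem posTrees_induction {P : Tree (Sequent Loc Ext) → Prop}
    (step : ∀ θ ts ps s, θ.Node ts s → Tree.Roots ts ps → PosR M ps s →
      (∀ t ∈ ts, t ∈ PosTrees M) → (∀ t ∈ ts, P t) → P θ)
    {θ : Tree (Sequent Loc Ext)} (h : θ ∈ PosTrees M) : P θ := by
  -- Intersecting `P` with the positive trees makes membership of the subtrees available in the
  -- induction step.
  have key : PosTrees M ≤ {θ | θ ∈ PosTrees M ∧ P θ} := by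
    refine OrderHom.lfp_le _ ?_
    rintro θ ⟨ts, ps, s, h₁, h₂, h₃, h₄⟩
    refine ⟨?_, step θ ts ps s h₁ h₂ h₃ (fun t ht => (h₄ t ht).1) fun t ht => (h₄ t ht).2⟩
    rw [PosTrees, ← OrderHom.map_lfp]
    exact ⟨ts, ps, s, h₁, h₂, h₃, fun t ht => (h₄ t ht).1⟩
  exact (key h).2

/-- Connects trees with the derivability in terms of which the soundness of the filter and of `eval`
is stated. -/
theorem posTrees_derivable {θ : Tree (Sequent Loc Ext)} (h : θ ∈ PosTrees M) :
    ∀ s, θ.root = some s → Derivable M s := by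
  refine posTrees_induction (P := fun θ => ∀ s, θ.root = some s → Derivable M s) ?_ h
  intro θ ts ps s hn hr hp _ ih s' hs
  cases hn.1.symm.trans hs
  refine .mk hp fun p hpp => ?_
  obtain ⟨t, ht, htp⟩ := hr.exists_tree hpp
  exact ih t ht p htp

/-- The roots of the trees have the same environments and corresponding configurations. -/
def RootCorr (D : AbsDom Loc Ext A) (θ : Tree (Sequent Loc Ext))
    (θA : Tree (ASequent A Loc Ext)) : Prop :=
  ∃ s sA, θ.root = some s ∧ θA.root = some sA ∧ Corr D s sA

/-- Every abstract tree that corresponds to `θ` at the root approximates `θ` at the root. -/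
def RootSound (D : AbsSem Ext M A) (θ : Tree (Sequent Loc Ext)) : Prop :=
  ∀ θA ∈ AbstractTrees D, ∀ s sA, θ.root = some s → θA.root = some sA →
    Corr D.toAbsDom s sA → SeqApprox D.toAbsDom s sA

/-- Premises that are roots of positive trees discharge the conditions in `Sim`: the tree gives
derivability and `RootSound` gives approximation. What is left, `rest`, is empty for a positive tree
and starts at the divergent premise for a negative one. -/
theorem Sim.append {psA : List (ASequent A Loc Ext)} {G : Prop}
    {ts : List (Tree (Sequent Loc Ext))} {pre rest : List (Sequent Loc Ext)}
    {tsA : List (Tree (ASequent A Loc Ext))} (hs : Sim D psA G (pre ++ rest))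
    (hr : Tree.Roots ts pre) (ht : ∀ t ∈ ts, t ∈ PosTrees M ∧ RootSound D t)
    (hrA : Tree.Roots tsA psA) (htA : ∀ t ∈ tsA, t ∈ AbstractTrees D) :
    (∀ t ∈ ts, ∃ tA ∈ tsA, RootCorr D.toAbsDom t tA) ∧ Sim D psA G rest := by
  induction hr with
  | nil => exact ⟨fun _ h => absurd h List.not_mem_nil, hs⟩
  | @cons t p ts ps hp _ ih =>
    obtain ⟨pA, hpA, hc, hk⟩ := hs
    obtain ⟨tA, htAm, htAr⟩ := hrA.exists_tree hpA
    obtain ⟨h₁, h₂⟩ := ht t (.head _)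
    obtain ⟨h₃, h₄⟩ := ih (hk (posTrees_derivable h₁ p hp) (h₂ tA (htA tA htAm) p pA hp htAr hc))
      fun t ht' => ht t (.tail _ ht')
    refine ⟨fun t' ht' => ?_, h₄⟩
    cases ht' with
    | head => exact ⟨tA, htAm, p, pA, hp, htAr, hc⟩
    | tail _ ht' => exact h₃ t' ht'

/-- Both forms of abstract rule retain the premises of a schema instance, hence the simulation
always applies. For a supported configuration the schema result is ignored, and soundness of `eval`
on the given derivation takes its place. -/
theorem AbsR.exists_schema {psA : List (ASequent A Loc Ext)} {q : Kind} {ρ : Env Loc Ext}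
    {β : TEnv} {NA : ANT A Loc Ext q} {ηA : ATm A Loc Ext q}
    (h : AbsR D psA (.mk q ρ β NA ηA)) :
    ∃ η₀, AbsSchema D psA (.mk q ρ β NA η₀) ∧ ∀ N η, NTApprox D.toAbsDom N NA →
      Derivable M (.pos q ρ β N η) → TmApprox D.toAbsDom η η₀ → TmApprox D.toAbsDom η ηA := by
  cases h with
  | unsupported hs _ hle => exact ⟨_, hs, fun _ _ _ _ h => h.mono hle⟩
  | supported hs hsup hev hle _ hwf =>
    refine ⟨_, hs, fun N η hN hd _ => ?_⟩
    obtain ⟨η₁, h₁, h₂⟩ := D.eval_sound _ _ _ _ hwf.1 hwf.2 hsup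
    cases hev.symm.trans h₁
    exact (h₂ N η hN hd).mono hle

theorem posTrees_rootSound {θ : Tree (Sequent Loc Ext)} (h : θ ∈ PosTrees M) :
    RootSound D θ := by
  refine posTrees_induction (P := RootSound D) ?_ h
  rintro θ ts ps s hn hr hp hts ih θA hA s' _ hs hsA (hN | hN)
  · cases hn.1.symm.trans hs
    obtain ⟨tsA, psA, sA, hnA, hrA, hR, htsA⟩ := abstractTrees_unfold hA
    cases hnA.1.symm.trans hsA
    obtain ⟨η₀, hsch, hmono⟩ := hR.exists_schema
    have hsim := hp.1.sim hsch hN hp.2.2.1 hp.2.2.2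
    rw [← List.append_nil ps] at hsim
    obtain ⟨-, hη⟩ := hsim.append hr (fun t ht => ⟨hts t ht, ih t ht⟩) hrA htsA
    refine .pos hN (hmono _ _ hN (.mk hp fun p hpp => ?_) hη)
    obtain ⟨t, ht, htp⟩ := hr.exists_tree hpp
    exact posTrees_derivable (hts t ht) p htp
  · exact .neg hN

/-- The propagation step of the coinduction, obtained by running the simulation over the premises
and locating the abstract subtree of each partner. -/
theorem RootCorr.subtrees {θ : Tree (Sequent Loc Ext)} {θA : Tree (ASequent A Loc Ext)}
    (hθ : θ ∈ ConcreteTrees M) (hA : θA ∈ AbstractTrees D) (h : RootCorr D.toAbsDom θ θA)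
    {i : ℕ} (hi : (θ.label [i]).isSome) :
    θ.sub [i] ∈ ConcreteTrees M ∧ ∃ j, (θA.label [j]).isSome ∧
      θA.sub [j] ∈ AbstractTrees D ∧ RootCorr D.toAbsDom (θ.sub [i]) (θA.sub [j]) := by
  obtain ⟨s, sA, hs, hsA, hc⟩ := h
  obtain ⟨tsA, psA, sA', hnA, hrA, hR, htsA⟩ := abstractTrees_unfold hA
  cases hnA.1.symm.trans hsA
  suffices hsuff : θ.sub [i] ∈ ConcreteTrees M ∧
      ∃ tA ∈ tsA, RootCorr D.toAbsDom (θ.sub [i]) tA by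
    obtain ⟨h₁, tA, htA, h₂⟩ := hsuff
    obtain ⟨j, hj, rfl⟩ := hnA.exists_sub htA
    exact ⟨h₁, j, hj, htsA _ htA, h₂⟩
  rcases hθ with hθ | hθ
  · obtain ⟨ts, ps, s', hn, hr, hp, hts⟩ := posTrees_unfold hθ
    cases hn.1.symm.trans hs
    have hm := hn.sub_mem hi
    refine ⟨.inl (hts _ hm), ?_⟩
    cases hc with
    | neg => cases hp.1
    | pos hN =>
      obtain ⟨η₀, hsch, -⟩ := hR.exists_schema
      have hsim := hp.1.sim hsch hN hp.2.2.1 hp.2.2.2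
      rw [← List.append_nil ps] at hsim
      exact (hsim.append hr (fun t ht => ⟨hts t ht, posTrees_rootSound (hts t ht)⟩) hrA htsA).1 _ hm
  · obtain ⟨ts, t, ps, s', hn, hr, hneg, hts, ht⟩ := negTrees_unfold hθ
    cases hn.1.symm.trans hs
    have hm := hn.sub_mem hi
    refine ⟨(List.mem_append.1 hm).elim (fun h => .inl (hts _ h)) fun h =>
      .inr (List.mem_singleton.1 h ▸ ht), ?_⟩
    cases hneg with
    | @mk pre post q₀ ρ₀ β₀ N₀ η' _ _ _ _ η _ _ hp =>
      cases hc with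
      | neg hN =>
        obtain ⟨η₀, hsch, -⟩ := hR.exists_schema
        -- The positive rule behind the negative one is simulated in full, although its result `η`
        -- and its later premises need not be realised by any tree; only the part up to the
        -- divergent premise is used.
        have hsim := hp.1.sim hsch hN hp.2.2.1 hp.2.2.2
        have hlen : ts.length = pre.length := by
          have := List.Forall₂.length_eq hr
          simpa using this
        have hr' : Tree.Roots ts pre := by
          have := List.forall₂_take ts.length hr
          rwa [List.take_left, hlen, List.take_left] at this
        have hrt : t.root = some (.neg q₀ ρ₀ β₀ N₀) := by
          have := List.forall₂_drop ts.length hr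
          rw [List.drop_left, hlen, List.drop_left] at this
          cases this; assumption
        obtain ⟨h₁, pA, hpA, hc₀, -⟩ :=
          hsim.append hr' (fun t ht => ⟨hts t ht, posTrees_rootSound (hts t ht)⟩) hrA htsA
        rcases List.mem_append.1 hm with hm | hm
        · exact h₁ _ hm
        · obtain ⟨tA, htA, htAr⟩ := hrA.exists_tree hpA
          rw [List.mem_singleton.1 hm]
          cases hc₀ with
          -- The partner was found for the terminating version of the premise. Since correspondence
          -- ignores results, it also serves for the divergent one.
          | pos hN₀ => exact ⟨tA, htA, _, _, hrt, htAr, .neg hN₀⟩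

theorem RootCorr.seqApprox {θ : Tree (Sequent Loc Ext)} {θA : Tree (ASequent A Loc Ext)}
    (hθ : θ ∈ ConcreteTrees M) (hA : θA ∈ AbstractTrees D) (h : RootCorr D.toAbsDom θ θA) :
    ∃ s sA, θ.root = some s ∧ θA.root = some sA ∧ SeqApprox D.toAbsDom s sA := by
  obtain ⟨s, sA, hs, hsA, hc⟩ := h
  refine ⟨s, sA, hs, hsA, ?_⟩
  rcases hθ with hθ | hθ
  · exact posTrees_rootSound hθ θA hA s sA hs hsA hc
  · obtain ⟨ts, t, ps, s', hn, hr, hneg, hts, ht⟩ := negTrees_unfold hθ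
    cases hn.1.symm.trans hs
    cases hneg
    cases hc with | neg hN => exact .neg hN

theorem RootCorr.treeApprox {θ : Tree (Sequent Loc Ext)} {θA : Tree (ASequent A Loc Ext)}
    (hθ : θ ∈ ConcreteTrees M) (hA : θA ∈ AbstractTrees D) (h : RootCorr D.toAbsDom θ θA) :
    TreeApprox D θ θA := by
  have key : {x : Tree (Sequent Loc Ext) × Tree (ASequent A Loc Ext) | x.1 ∈ ConcreteTrees M ∧
      x.2 ∈ AbstractTrees D ∧ RootCorr D.toAbsDom x.1 x.2} ≤ (Fapprox D).gfp := by
    -- Coinduction: the pairs with corresponding roots form a post-fixpoint of `Fapprox D`.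
    refine OrderHom.le_gfp _ ?_
    rintro x ⟨h₁, h₂, h₃⟩
    refine ⟨h₁, h₂, h₃.seqApprox h₁ h₂, fun i hi => ?_⟩
    obtain ⟨h₄, j, hj, h₅, h₆⟩ := h₃.subtrees h₁ h₂ hi
    exact ⟨j, hj, h₄, h₅, h₆⟩
  exact key ⟨hθ, hA, h⟩

end TreeSoundness

end CPM

theorem mainTheorem1 {Loc Ext : Type u} (M : CPM.MemImpl Loc) (A : CPM.Carriers.{u})
    (D : CPM.AbsSem Ext M A)
    (θ : CPM.Tree (CPM.Sequent Loc Ext)) (θA : CPM.Tree (CPM.ASequent A Loc Ext))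
    (hθ : θ ∈ CPM.ConcreteTrees M) (hθA : θA ∈ CPM.AbstractTrees D)
    (q : CPM.Kind) (ρ : CPM.Env Loc Ext) (β : CPM.TEnv)
    (N : CPM.NT Loc Ext q) (NA : CPM.ANT A Loc Ext q) (ηA : CPM.ATm A Loc Ext q)
    (hroot : (∃ η : CPM.Tm Loc Ext q, θ.root = some (CPM.Sequent.pos q ρ β N η)) ∨
      θ.root = some (CPM.Sequent.neg q ρ β N))
    (hrootA : θA.root = some (CPM.ASequent.mk q ρ β NA ηA))
    (hN : CPM.NTApprox D.toAbsDom N NA) :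
    CPM.TreeApprox D θ θA := by
  refine CPM.RootCorr.treeApprox hθ hθA ?_
  rcases hroot with ⟨η, h⟩ | h
  · exact ⟨_, _, h, hrootA, .pos hN⟩
  · exact ⟨_, _, h, hrootA, .neg hN⟩
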